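/- **The model.** Let $\beta\in(0,1)$ be a known discount factor and let $W_0:\mathbb R^k\to\mathbb R^{k_0}$, $W_1:\mathbb R^k\to\mathbb R^{k_1}$ be known measurable functions. In each period $t=0,1,2,\dots$ an agent observes a state $X_t\in\mathbb R^k$ and shocks $\epsilon_t=(\epsilon_{0t},\epsilon_{1t})\in\mathbb R^2$ and chooses $Y_t\in\{0,1\}$; her per-period utility is $W_d(X_t)^\top\theta_d+\epsilon_{dt}$ if $Y_t=d$. A *structure* consists of a parameter $\theta=(\theta_0,\theta_1)\in\mathbb R^{k_0+k_1}$, a transition law of $(X_{t+1},\epsilon_{t+1})$ given $(X_t,\epsilon_t,Y_t)$, and the law of the resulting process $(X_t,\epsilon_t,Y_t)_{t\ge0}$, which is a stationary controlled Markov process in which $Y_t$ is given by a time-invariant decision rule that maximizes the expected $\beta$-discounted sum of utilities. Only $(X_t,Y_t)_{t\ge 0}$ is observed. Write $(X,\epsilon,Y)$ for a generic period and $^{[s]}$ for the value $s$ periods later. A real random variable is called *continuously distributed on* (or *with support*) $S$ if it has a Lebesgue density that vanishes off $S$ and is positive almost everywhere on $S$. Put $\eta=\epsilon_0-\epsilon_1$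 and $p(x)=\Pr(Y=1\mid X=x)$. All conditional statements hold almost surely. A structure is *admissible* if 1. the transition law satisfies $F_{X',\epsilon'|X,\epsilon,Y}=F_{\epsilon'}\times F_{X'|X,Y}$ and $F_{\epsilon'}=F_\epsilon$; 2. $\mathbb E\|\epsilon\|<\infty$ and $\eta$ is continuously distributed with support $\mathbb R$; 3. $\|\theta\|=1$. The distribution of the shocks is otherwise unrestricted. **Functionals of the distribution of the observables.** For $d=0,1$ let $$\phi_d(X)=(-1)^{d+1}W_d(X)+\sum_{s\ge1}\beta^s\Big\{\mathbb E\big[W_d(X^{[s]})\mathbb 1_{Y^{[s]}=d}\mid X,Y=1\big]-\mathbb E\big[W_d(X^{[s]})\mathbb 1_{Y^{[s]}=d}\mid X,Y=0\big]\Big\},$$ $\phi=(\phi_0,\phi_1)$, $z(p)=\mathbb E[\phi(X)\mid p(X)=p]$, and $$\Pi(q,p)=\sum_{s\ge1}\beta^{s-1}\big[F_{p(X^{[s]})|p(X),Y}(q|p,1)-F_{p(X^{[s]})|p(X),Y}(q|p,0)\big].$$ When $p(X)$ has support $[\underline p,\overline p]$, let $\mathcal B:[\underline p,\overline p]\to\mathbb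 R^{k_0+k_1}$ be the integrable solution, for almost every $p\in[\underline p,\overline p]$, of $$\mathcal B(p)+\sum_{s\ge1}\beta^s\Big\{\mathbb E\Big[\int_{\underline p}^{p(X^{[s]})}\mathcal B(\tau)\,d\tau\,\Big|\,p(X)=p,Y=1\Big]-\mathbb E\Big[\int_{\underline p}^{p(X^{[s]})}\mathcal B(\tau)\,d\tau\,\Big|\,p(X)=p,Y=0\Big]\Big\}=z(p),$$ and put $$m(X)=\phi(X)-\sum_{s\ge1}\beta^s\Big\{\mathbb E\Big[\int_{\underline p}^{p(X^{[s]})}\mathcal B(\tau)\,d\tau\,\Big|\,X,Y=1\Big]-\mathbb E\Big[\int_{\underline p}^{p(X^{[s]})}\mathcal B(\tau)\,d\tau\,\Big|\,X,Y=0\Big]\Big\}.$$ **Theorem.** Consider an admissible structure with parameter $\theta$ and suppose that the distribution of $(X_t,Y_t)_{t\ge0}$ that it generates satisfies the following. (a) For $d=0,1$, $\mathbb E(\|W_d(X^{[s]})\|\mid X)<\infty$ for all $s\ge1$; moreover $\sum_{s\ge1}\beta^s\,\mathbb E(\|W_d(X^{[s]})\|\mid X)<\infty$ and $\mathbb E\|\phi(X)\|<\infty$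 (so that $\phi$ and $z$ are well defined), and the equation for $\mathcal B$ has an integrable solution. (b) $p(X)$ is continuously distributed and its support is a closed interval $[\underline p,\overline p]\subseteq[0,1]$. (c) $\beta^2\int_{\underline p}^{\overline p}\int_{\underline p}^{\overline p}\Pi(q,p)^2\,dq\,dp<1$. (d) For some coordinate $j_0$ with $\theta_{j_0}\ne0$ (say the first one), the conditional distribution of $m_{j_0}(X)$ given the other coordinates $m_{-j_0}(X)$ is continuous on an interval, which may depend on $m_{-j_0}(X)$; $\mathbb E[m(X)m(X)^\top]$ exists and is invertible; and $m(X)$ contains no constant term, that is, no linear combination of its coordinates is almost surely equal to a nonzero constant. Then $\theta$ is point identified: every admissible structure (with the same $\beta,W_0,W_1$, but possibly different shock distribution and transition law) that generates the same distribution of $(X_t,Y_t)_{t\ge0}$ has the same parameter $\theta$. -/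

import Mathlib

open MeasureTheory ProbabilityTheory Set

noncomputable section

namespace DDC

/-! ### The dynamic binary choice problem -/

/-- Observed state variables `X_t`. -/
abbrev State (k : ℕ) := Fin k → ℝ

/-- Payoff shocks `ε_t = (ε_{0t}, ε_{1t})`. -/
abbrev Shock := ℝ × ℝ

/-- One period `(X_t, ε_t, Y_t)`; the action `true` is `Y = 1`, the action `false` is `Y = 0`. -/
abbrev Period (k : ℕ) := State k × Shock × Bool

/-- The observed part `(X_t, Y_t)` of a period. -/
abbrev Obs (k : ℕ) := State k × Bool

/-- Coordinates of `θ = (θ₀, θ₁)`. -/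
abbrev Coord (k₀ k₁ : ℕ) := Fin k₀ ⊕ Fin k₁

/-- The known transformations `W₀`, `W₁` of the state variables. -/
structure Transforms (k k₀ k₁ : ℕ) where
  W₀ : State k → EuclideanSpace ℝ (Fin k₀)
  W₁ : State k → EuclideanSpace ℝ (Fin k₁)
  measurable_W₀ : Measurable W₀
  measurable_W₁ : Measurable W₁

/-- A structure: the parameter `θ`, the transition law of `(X', ε')` given `(X, ε, Y)`, and the
joint law of the whole process `(X_t, ε_t, Y_t)`, `t = 0, 1, 2, …`. The distribution of the
shocks is the one under `law`. -/
structure Model (k k₀ k₁ : ℕ) where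
  θ : EuclideanSpace ℝ (Coord k₀ k₁)
  trans : Kernel (Period k) (State k × Shock)
  isMarkovKernel_trans : IsMarkovKernel trans
  law : Measure (ℕ → Period k)
  isProbabilityMeasure_law : IsProbabilityMeasure law

section Problem

variable {k k₀ k₁ : ℕ}

/-- Per-period utility of action `y` in state `(x, ε)`. -/
def utility (W : Transforms k k₀ k₁) (θ : EuclideanSpace ℝ (Coord k₀ k₁)) (y : Bool)
    (z : State k × Shock) : ℝ :=
  if y then ∑ i, W.W₁ z.1 i * θ (Sum.inr i) + z.2.2
  else ∑ i, W.W₀ z.1 i * θ (Sum.inl i) + z.2.1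

/-- A plan: at each date, an action as a (measurable) function of the current state. -/
structure Plan (k : ℕ) where
  act : ℕ → State k × Shock → Bool
  measurable_act : ∀ t, Measurable (act t)

/-- The plan that uses the same rule at every date. -/
def Plan.stationary (δ : State k × Shock → Bool) (hδ : Measurable δ) : Plan k where
  act := fun _ => δ
  measurable_act := fun _ => hδ

theorem measurable_decide {δ : State k × Shock → Bool} (hδ : Measurable δ) :
    Measurable (fun z : State k × Shock => ((z.1, z.2, δ z) : Period k)) :=
  measurable_fst.prodMk (measurable_snd.prodMk hδ)

/-- Law of the state `s` periods ahead, as a function of the current state, under a plan. -/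
def stateAfter (T : Kernel (Period k) (State k × Shock)) (σ : Plan k) :
    ℕ → Kernel (State k × Shock) (State k × Shock)
  | 0 => Kernel.id
  | s + 1 => (T.comap (fun z => (z.1, z.2, σ.act s z)) (measurable_decide (σ.measurable_act s))) ∘ₖ
      stateAfter T σ s

/-- The expected discounted sum of payoffs of a plan is absolutely convergent at `z`. -/
def PayoffDefined (W : Transforms k k₀ k₁) (β : ℝ) (θ : EuclideanSpace ℝ (Coord k₀ k₁))
    (T : Kernel (Period k) (State k × Shock)) (σ : Plan k) (z : State k × Shock) : Prop :=
  (∀ s, Integrable (fun z' => utility W θ (σ.act s z') z') (stateAfter T σ s z)) ∧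
  Summable (fun s => β ^ s * ∫ z', |utility W θ (σ.act s z') z'| ∂(stateAfter T σ s z))

/-- Expected discounted sum of payoffs of a plan, starting at `z`. -/
def payoff (W : Transforms k k₀ k₁) (β : ℝ) (θ : EuclideanSpace ℝ (Coord k₀ k₁))
    (T : Kernel (Period k) (State k × Shock)) (σ : Plan k) (z : State k × Shock) : ℝ :=
  ∑' s, β ^ s * ∫ z', utility W θ (σ.act s z') z' ∂(stateAfter T σ s z)

/-- At `z`, the plan maximizes the expected discounted sum of payoffs. -/
def IsOptimalAt (W : Transforms k k₀ k₁) (β : ℝ) (θ : EuclideanSpace ℝ (Coord k₀ k₁))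
    (T : Kernel (Period k) (State k × Shock)) (σ : Plan k) (z : State k × Shock) : Prop :=
  PayoffDefined W β θ T σ z ∧
  ∀ τ : Plan k, PayoffDefined W β θ T τ z → payoff W β θ T τ z ≤ payoff W β θ T σ z

/-- The process `(X_t, ε_t, Y_t)` is a stationary controlled Markov process with transition law
`trans`, whose actions are those of an optimal time-invariant decision rule. -/
structure IsEquilibrium (W : Transforms k k₀ k₁) (β : ℝ) (M : Model k k₀ k₁) : Prop where
  stationary : M.law.map (fun ω t => ω (t + 1)) = M.law
  markov : ∀ t : ℕ,
    M.law.map (fun ω =>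
      ((fun i : Fin (t + 1) => ω i), ((ω (t + 1)).1, (ω (t + 1)).2.1))) =
    (M.law.map (fun ω => fun i : Fin (t + 1) => ω i)) ⊗ₘ
      (M.trans.comap (fun h : Fin (t + 1) → Period k => h (Fin.last t))
        (measurable_pi_apply (Fin.last t)))
  optimal : ∃ (δ : State k × Shock → Bool) (hδ : Measurable δ),
    (∀ t, ∀ᵐ ω ∂M.law, (ω t).2.2 = δ ((ω t).1, (ω t).2.1)) ∧
    ∀ᵐ ω ∂M.law,
      IsOptimalAt W β M.θ M.trans (Plan.stationary δ hδ) ((ω 0).1, (ω 0).2.1)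

/-- The distribution of the shocks `ε = (ε₀, ε₁)`. -/
def Model.shockLaw (M : Model k k₀ k₁) : Measure Shock :=
  M.law.map (fun ω => (ω 0).2.1)

/-- The distribution of `η = ε₀ - ε₁`. -/
def Model.etaLaw (M : Model k k₀ k₁) : Measure ℝ :=
  M.shockLaw.map (fun e => e.1 - e.2)

/-- The distribution of the observed process `(X_t, Y_t)`, `t = 0, 1, 2, …`. -/
def Model.observed (M : Model k k₀ k₁) : Measure (ℕ → Obs k) :=
  M.law.map (fun ω t => ((ω t).1, (ω t).2.2))

instance (M : Model k k₀ k₁) : IsProbabilityMeasure M.observed := by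
  have := M.isProbabilityMeasure_law
  refine Measure.isProbabilityMeasure_map (Measurable.aemeasurable ?_)
  fun_prop

/-- Conditional independence: `F_{X',ε'|X,ε,Y} = F_{ε'} × F_{X'|X,Y}` and `F_{ε'} = F_ε`. -/
def CondIndep (M : Model k k₀ k₁) : Prop :=
  ∃ κ : Kernel (State k × Bool) (State k), IsMarkovKernel κ ∧
    ∀ (x : State k) (e : Shock) (y : Bool), M.trans (x, e, y) = (κ (x, y)).prod M.shockLaw

end Problem

/-- `μ` is a continuous distribution with support `S`: it has a Lebesgue density that vanishes
outside `S` and is positive almost everywhere on `S`. -/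
def ContinuouslyDistributedOn (μ : Measure ℝ) (S : Set ℝ) : Prop :=
  μ ≪ volume.restrict S ∧ volume.restrict S ≪ μ

/-! ### Functionals of the distribution `D` of the observed process -/

section Observables

variable {k k₀ k₁ : ℕ}

/-- The distribution of `X`. -/
def stateLaw (D : Measure (ℕ → Obs k)) : Measure (State k) :=
  D.map (fun ω => (ω 0).1)

instance (D : Measure (ℕ → Obs k)) [IsProbabilityMeasure D] :
    IsProbabilityMeasure (stateLaw D) := by
  refine Measure.isProbabilityMeasure_map (Measurable.aemeasurable ?_)
  fun_prop

/-- The choice probability `p(x) = Pr(Y = 1 | X = x)`. -/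
def choiceProb (D : Measure (ℕ → Obs k)) [IsProbabilityMeasure D] (x : State k) : ℝ :=
  (condDistrib (fun ω : ℕ → Obs k => (ω 0).2) (fun ω => (ω 0).1) D x).real {true}

/-- `∑_{s ≥ 1} β^s {E[f(X^{[s]}, Y^{[s]}) | X = x, Y = 1] - E[f(X^{[s]}, Y^{[s]}) | X = x, Y = 0]}`. -/
def stateDiff (D : Measure (ℕ → Obs k)) [IsProbabilityMeasure D] (β : ℝ) (f : Obs k → ℝ)
    (x : State k) : ℝ :=
  ∑' s : ℕ, β ^ (s + 1) *
    ((∫ o, f o ∂(condDistrib (fun ω : ℕ → Obs k => ω (s + 1)) (fun ω => ω 0) D (x, true))) -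
      ∫ o, f o ∂(condDistrib (fun ω : ℕ → Obs k => ω (s + 1)) (fun ω => ω 0) D (x, false)))

/-- The conditional distribution of `p(X^{[s]})` given `(p(X), Y)`. -/
def scoreKernel (D : Measure (ℕ → Obs k)) [IsProbabilityMeasure D] (s : ℕ) :
    Kernel (ℝ × Bool) ℝ :=
  condDistrib (fun ω : ℕ → Obs k => choiceProb D (ω s).1)
    (fun ω => (choiceProb D (ω 0).1, (ω 0).2)) D

/-- `∑_{s ≥ 1} β^s {E[g(p(X^{[s]})) | p(X) = p, Y = 1] - E[g(p(X^{[s]})) | p(X) = p, Y = 0]}`. -/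
def scoreDiff (D : Measure (ℕ → Obs k)) [IsProbabilityMeasure D] (β : ℝ) (g : ℝ → ℝ)
    (p : ℝ) : ℝ :=
  ∑' s : ℕ, β ^ (s + 1) *
    ((∫ q, g q ∂(scoreKernel D (s + 1) (p, true))) -
      ∫ q, g q ∂(scoreKernel D (s + 1) (p, false)))

/-- `Π(q, p; β) = ∑_{s ≥ 1} β^{s-1} [F_{p(X^{[s]})|p(X),Y}(q|p,1) - F_{p(X^{[s]})|p(X),Y}(q|p,0)]`. -/
def bigPi (D : Measure (ℕ → Obs k)) [IsProbabilityMeasure D] (β : ℝ) (q p : ℝ) : ℝ :=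
  ∑' s : ℕ, β ^ s *
    ((scoreKernel D (s + 1) (p, true)).real (Iic q) -
      (scoreKernel D (s + 1) (p, false)).real (Iic q))

/-- `φ_d(X) = (-1)^{d+1} W_d + ∑_{s ≥ 1} β^s {E[W_d^{[s]} 1(Y^{[s]} = d) | X, Y = 1]
- E[W_d^{[s]} 1(Y^{[s]} = d) | X, Y = 0]}`, stacked over `d = 0, 1`. -/
def phi (W : Transforms k k₀ k₁) (β : ℝ) (D : Measure (ℕ → Obs k)) [IsProbabilityMeasure D] :
    Coord k₀ k₁ → State k → ℝ
  | Sum.inl i, x => -W.W₀ x i + stateDiff D β (fun o => if o.2 then 0 else W.W₀ o.1 i) x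
  | Sum.inr i, x => W.W₁ x i + stateDiff D β (fun o => if o.2 then W.W₁ o.1 i else 0) x

/-- `z(p) = E[φ(X) | p(X) = p]`. -/
def zFun (W : Transforms k k₀ k₁) (β : ℝ) (D : Measure (ℕ → Obs k)) [IsProbabilityMeasure D]
    (j : Coord k₀ k₁) (p : ℝ) : ℝ :=
  ∫ x, phi W β D j x
    ∂(condDistrib (fun ω : ℕ → Obs k => (ω 0).1) (fun ω => choiceProb D (ω 0).1) D p)

/-- `B = (b_j)` solves, on the support `[pl, pu]` of `p(X)`, the integral equations
`b_j(p) + ∑_{s ≥ 1} β^s {E[∫_{pl}^{p(X^{[s]})} b_j | p(X) = p, Y = 1]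
- E[∫_{pl}^{p(X^{[s]})} b_j | p(X) = p, Y = 0]} = z_j(p)`. -/
def IsBasisSolution (W : Transforms k k₀ k₁) (β : ℝ) (D : Measure (ℕ → Obs k))
    [IsProbabilityMeasure D] (pl pu : ℝ) (B : Coord k₀ k₁ → ℝ → ℝ) : Prop :=
  ∀ j, IntegrableOn (B j) (Icc pl pu) ∧
    ∀ᵐ p ∂(volume.restrict (Icc pl pu)),
      B j p + scoreDiff D β (fun q => ∫ τ in pl..q, B j τ) p = zFun W β D j p

/-- The single-index variables `m(X) = φ(X) - ∑_{s ≥ 1} β^s {E[∫_{pl}^{p(X^{[s]})} B | X, Y = 1]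
- E[∫_{pl}^{p(X^{[s]})} B | X, Y = 0]}`. -/
def mIndex (W : Transforms k k₀ k₁) (β : ℝ) (D : Measure (ℕ → Obs k)) [IsProbabilityMeasure D]
    (pl : ℝ) (B : Coord k₀ k₁ → ℝ → ℝ) (j : Coord k₀ k₁) (x : State k) : ℝ :=
  phi W β D j x - stateDiff D β (fun o => ∫ τ in pl..(choiceProb D o.1), B j τ) x

/-- `E(‖f(X^{[s]})‖ | X) < ∞` for all `s ≥ 1`, and the discounted sum of these is finite. -/
def DiscountedFinite {E : Type*} [NormedAddCommGroup E] (β : ℝ) (D : Measure (ℕ → Obs k))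
    [IsProbabilityMeasure D] (f : State k → E) : Prop :=
  (∀ s : ℕ, 1 ≤ s → ∀ᵐ x ∂(stateLaw D), ∫⁻ x', ‖f x'‖ₑ
    ∂(condDistrib (fun ω : ℕ → Obs k => (ω s).1) (fun ω => (ω 0).1) D x) < ⊤) ∧
  ∀ᵐ x ∂(stateLaw D), ∑' s : ℕ, ENNReal.ofReal (β ^ (s + 1)) * ∫⁻ x', ‖f x'‖ₑ
    ∂(condDistrib (fun ω : ℕ → Obs k => (ω (s + 1)).1) (fun ω => (ω 0).1) D x) < ⊤

/-- Regularity: the discounted expectations that define `φ` are finite and `E[φ(X) | p(X)]`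
exists. -/
structure Regular (W : Transforms k k₀ k₁) (β : ℝ) (D : Measure (ℕ → Obs k))
    [IsProbabilityMeasure D] : Prop where
  finite_W₀ : DiscountedFinite β D W.W₀
  finite_W₁ : DiscountedFinite β D W.W₁
  integrable_phi : ∀ j, Integrable (phi W β D j) (stateLaw D)

/-- `p(X)` is continuously distributed and its support is the closed interval `[pl, pu]`. -/
def ScoreInterval (D : Measure (ℕ → Obs k)) [IsProbabilityMeasure D] (pl pu : ℝ) : Prop :=
  ContinuouslyDistributedOn ((stateLaw D).map (choiceProb D)) (Icc pl pu)

/-- `β² ∫∫ Π²(q, p; β) dq dp < 1`. -/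
def Contraction (β : ℝ) (D : Measure (ℕ → Obs k)) [IsProbabilityMeasure D] (pl pu : ℝ) : Prop :=
  β ^ 2 * ∫ p in Icc pl pu, ∫ q in Icc pl pu, bigPi D β q p ^ 2 < 1

/-- Conditions on a random vector `m(X)`: given the other coordinates, the coordinate `j₀` is
continuously distributed on an interval; `E[m(X) m(X)ᵀ]` exists and is invertible; and `m(X)`
contains no constant term, i.e. no linear combination of its coordinates is a nonzero constant. -/
structure IndexCondition (D : Measure (ℕ → Obs k)) [IsProbabilityMeasure D]
    (m : Coord k₀ k₁ → State k → ℝ) (j₀ : Coord k₀ k₁) : Prop where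
  continuous_coord :
    ∀ᵐ y ∂((stateLaw D).map (fun x => fun j : {j : Coord k₀ k₁ // j ≠ j₀} => m j x)),
      ∃ I : Set ℝ, I.OrdConnected ∧
        ContinuouslyDistributedOn
          (condDistrib (m j₀) (fun x => fun j : {j : Coord k₀ k₁ // j ≠ j₀} => m j x)
            (stateLaw D) y) I
  memLp : ∀ j, MemLp (m j) 2 (stateLaw D)
  invertible :
    IsUnit (Matrix.of (fun i j : Coord k₀ k₁ => ∫ x, m i x * m j x ∂(stateLaw D))).det
  no_constant : ∀ (a : Coord k₀ k₁ → ℝ) (c : ℝ),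
    (∀ᵐ x ∂(stateLaw D), ∑ j, a j * m j x = c) → c = 0

end Observables

/-! ### Identification -/

section Identification

variable {k k₀ k₁ : ℕ}

/-- The structures under consideration: optimal stationary behaviour, conditional independence,
shocks with finite means, `η` continuously distributed with full support, and `‖θ‖ = 1`. The
shock distribution is otherwise unrestricted. -/
structure Admissible (W : Transforms k k₀ k₁) (β : ℝ) (M : Model k k₀ k₁) : Prop where
  equilibrium : IsEquilibrium W β M
  condIndep : CondIndep M
  shock_integrable : Integrable (fun e : Shock => e) M.shockLaw
  eta_continuous : ContinuouslyDistributedOn M.etaLaw univ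
  norm_theta : ‖M.θ‖ = 1

/-- `θ` is point identified at the structure `M` within a class of structures: every structure
of the class that generates the same distribution of the observables has the same `θ`. -/
def PointIdentified (C : Set (Model k k₀ k₁)) (M : Model k k₀ k₁) : Prop :=
  ∀ M' ∈ C, M'.observed = M.observed → M'.θ = M.θ

end Identification

end DDC

end

/-!
Let `Q` be the quantile function of `η = ε₀ - ε₁`. Comparing the optimal rule with the plan that
deviates from it once shows that action `1` is chosen when `η` is at most the difference of the
choice-specific values, so `Q (p (X))` equals that difference. The shocks are independent of the
state, and the expected shock of the chosen action is a constant minus `∫_0^{p (X)} Q`. Hence the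
difference of values is `θ·φ(X)` minus the discounted difference of expectations of the primitive of
`Q` at future choice probabilities (`ae_quantile_eq`). Both actions have positive probability in
almost every state, so the transition laws that enter here are determined by the observables.

Given `p (X)`, the action is independent of the state (`map_score_eq_compProd`), so averaging the
equation over the states with `p (X) = p` yields the integral equation of `θ·B` for `Q`. After an
integration by parts the homogeneous equation reads `h = β ∫ Π h`. Its integrable solutions are
bounded, because `Π` is, hence square integrable, and the contraction condition makes them vanish
(`ae_eq_zero_of_homogeneous`). So `Q = θ·B` on the support of `p (X)`, and `Q (p (X)) = θ·m(X)`
(`ae_eq_index`).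

Two observationally equivalent structures thus satisfy `θ·m(X) = G (θ'·m(X))`, where `G = Q ∘ F'` is
an increasing homeomorphism of `ℝ`. Varying one coordinate of `m(X)` on an interval, with the others
fixed, shows that `G` is affine with slope `r = θ_{j₀} / θ'_{j₀}` near `θ'·m(X)` almost surely. These
neighbourhoods need not overlap, and a singular increase between them has to be excluded: both laws
of `η` have the null sets of Lebesgue measure, so `G` preserves null sets, and as the law of
`θ'·m(X)` has the null sets of Lebesgue measure on an interval, `G` is affine on all of that interval
(`exists_affine_of_ae_locally_affine`). So `(θ - r θ')·m(X)` is constant; the constant is zero since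
`m(X)` has no constant term, `θ = r θ'` since the second moments are invertible, and `r = 1` since
`r > 0` and both parameters have norm one (`eq_of_single_index`).
-/

noncomputable section

namespace DDC

/-! ### Quantile functions of continuous distributions with full support -/

section Quantile

variable {μ : Measure ℝ}

theorem ContinuouslyDistributedOn.noAtoms {S : Set ℝ} (h : ContinuouslyDistributedOn μ S) :
    NullSingletonClass μ :=
  ⟨fun _ => h.1 (measure_singleton _)⟩

theorem cdf_strictMono [IsProbabilityMeasure μ] (h : ContinuouslyDistributedOn μ univ) :
    StrictMono (cdf μ) := by
  intro a b hab
  refine lt_of_le_of_ne (monotone_cdf μ hab.le) fun he => ?_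
  have h1 : μ (Ioc a b) = 0 := by
    have := (cdf μ).measure_Ioc a b
    rw [measure_cdf] at this
    simp [this, he]
  have h2 : volume (Ioc a b) = 0 := by simpa using h.2 h1
  simp at h2
  linarith

theorem cdf_continuous [IsProbabilityMeasure μ] [NullSingletonClass μ] : Continuous (cdf μ) := by
  rw [continuous_iff_continuousAt]
  intro x
  have h1 : (cdf μ).measure {x} = 0 := by rw [measure_cdf]; simp
  rw [StieltjesFunction.measure_singleton, ENNReal.ofReal_eq_zero] at h1
  rw [(monotone_cdf μ).continuousAt_iff_leftLim_eq_rightLim, (cdf μ).rightLim_eq]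
  exact le_antisymm ((monotone_cdf μ).leftLim_le le_rfl) (by linarith)

/-- The quantile function of `μ`: the inverse of its distribution function. -/
def quantile (μ : Measure ℝ) : ℝ → ℝ := Function.invFun (cdf μ)

theorem quantile_cdf [IsProbabilityMeasure μ] (h : ContinuouslyDistributedOn μ univ) (t : ℝ) :
    quantile μ (cdf μ t) = t :=
  Function.leftInverse_invFun (cdf_strictMono h).injective t

theorem cdf_mem_Ioo [IsProbabilityMeasure μ] (h : ContinuouslyDistributedOn μ univ) (t : ℝ) :
    cdf μ t ∈ Ioo (0 : ℝ) 1 :=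
  ⟨(cdf_nonneg μ (t - 1)).trans_lt (cdf_strictMono h (by linarith)),
    (cdf_strictMono h (by linarith : t < t + 1)).trans_le (cdf_le_one μ _)⟩

theorem cdf_quantile [IsProbabilityMeasure μ] (h : ContinuouslyDistributedOn μ univ) {p : ℝ}
    (hp : p ∈ Ioo (0 : ℝ) 1) : cdf μ (quantile μ p) = p := by
  have := h.noAtoms
  refine Function.invFun_eq ?_
  exact mem_range_of_exists_le_of_exists_ge cdf_continuous
    (((tendsto_cdf_atBot μ).eventually (gt_mem_nhds hp.1)).exists.imp fun _ h => h.le)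
    (((tendsto_cdf_atTop μ).eventually (lt_mem_nhds hp.2)).exists.imp fun _ h => h.le)

theorem quantile_le_iff [IsProbabilityMeasure μ] (h : ContinuouslyDistributedOn μ univ) {p : ℝ}
    (hp : p ∈ Ioo (0 : ℝ) 1) (t : ℝ) : quantile μ p ≤ t ↔ p ≤ cdf μ t := by
  rw [← (cdf_strictMono h).le_iff_le, cdf_quantile h hp]

theorem quantile_strictMonoOn [IsProbabilityMeasure μ] (h : ContinuouslyDistributedOn μ univ) :
    StrictMonoOn (quantile μ) (Ioo 0 1) := by
  intro p hp q hq hpq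
  rwa [← (cdf_strictMono h).lt_iff_lt, cdf_quantile h hp, cdf_quantile h hq]

theorem aemeasurable_quantile [IsProbabilityMeasure μ] (h : ContinuouslyDistributedOn μ univ) :
    AEMeasurable (quantile μ) (volume.restrict (Ioo 0 1)) :=
  aemeasurable_restrict_of_monotoneOn measurableSet_Ioo (quantile_strictMonoOn h).monotoneOn

/-- The quantile function pushes the uniform distribution on `(0, 1)` forward to `μ`. -/
theorem map_quantile [IsProbabilityMeasure μ] (h : ContinuouslyDistributedOn μ univ) :
    (volume.restrict (Ioo (0 : ℝ) 1)).map (quantile μ) = μ := by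
  have hq := aemeasurable_quantile h
  have : IsFiniteMeasure ((volume.restrict (Ioo (0 : ℝ) 1)).map (quantile μ)) := by
    infer_instance
  refine Measure.ext_of_Iic _ _ fun t => ?_
  rw [Measure.map_apply_of_aemeasurable hq measurableSet_Iic,
    Measure.restrict_apply₀' measurableSet_Ioo.nullMeasurableSet]
  have : quantile μ ⁻¹' Iic t ∩ Ioo 0 1 = Ioc 0 (cdf μ t) := by
    have := cdf_mem_Ioo h t
    ext p
    constructor
    · rintro ⟨h1, h2⟩
      exact ⟨h2.1, (quantile_le_iff h h2 t).1 h1⟩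
    · rintro ⟨h1, h2⟩
      have h3 : p ∈ Ioo (0 : ℝ) 1 := ⟨h1, h2.trans_lt this.2⟩
      exact ⟨(quantile_le_iff h h3 t).2 h2, h3⟩
  rw [this, Real.volume_Ioc, sub_zero, ← ofReal_cdf μ t]

theorem integrableOn_quantile [IsProbabilityMeasure μ] (h : ContinuouslyDistributedOn μ univ)
    (hi : Integrable (fun t => t) μ) : IntegrableOn (quantile μ) (Icc 0 1) := by
  rw [integrableOn_Icc_iff_integrableOn_Ioo]
  rw [← map_quantile h] at hi
  exact (integrable_map_measure (by fun_prop) (aemeasurable_quantile h)).1 hi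

theorem setIntegral_Iic_eq_integral_quantile [IsProbabilityMeasure μ]
    (h : ContinuouslyDistributedOn μ univ) (t : ℝ) :
    ∫ u in Iic t, u ∂μ = ∫ τ in (0 : ℝ)..cdf μ t, quantile μ τ := by
  have ht := cdf_mem_Ioo h t
  conv_lhs => rw [← map_quantile h]
  rw [← integral_indicator measurableSet_Iic, integral_map (aemeasurable_quantile h)
    (measurable_id'.indicator measurableSet_Iic).aestronglyMeasurable, intervalIntegral.integral_of_le ht.1.le,
    ← integral_indicator measurableSet_Ioo, ← integral_indicator measurableSet_Ioc]
  congr 1 with p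
  by_cases hp : p ∈ Ioo (0 : ℝ) 1
  · simp only [indicator, hp, mem_Iic, mem_Ioc, quantile_le_iff h hp, if_true, hp.1, true_and]
  · rw [indicator_of_notMem hp, indicator_of_notMem]
    exact fun h' => hp ⟨h'.1, h'.2.trans_lt ht.2⟩

end Quantile

/-! ### Transport between two continuous distributions -/

section Transport

open Filter Topology

variable {μ ν : Measure ℝ} [IsProbabilityMeasure μ] [IsProbabilityMeasure ν]

theorem quantile_cdf_quantile_cdf (hμ : ContinuouslyDistributedOn μ univ)
    (hν : ContinuouslyDistributedOn ν univ) (t : ℝ) :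
    quantile μ (cdf ν (quantile ν (cdf μ t))) = t := by
  rw [cdf_quantile hν (cdf_mem_Ioo hμ t), quantile_cdf hμ]

/-- The increasing rearrangement `F_μ⁻¹ ∘ F_ν` of `ν` to `μ`, as an order isomorphism of `ℝ`. -/
def transport (hμ : ContinuouslyDistributedOn μ univ) (hν : ContinuouslyDistributedOn ν univ) :
    ℝ ≃o ℝ :=
  StrictMono.orderIsoOfRightInverse (fun t => quantile μ (cdf ν t))
    (fun _ _ h => quantile_strictMonoOn hμ (cdf_mem_Ioo hν _) (cdf_mem_Ioo hν _)
      (cdf_strictMono hν h))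
    (fun t => quantile ν (cdf μ t)) (quantile_cdf_quantile_cdf hμ hν)

theorem transport_apply (hμ : ContinuouslyDistributedOn μ univ)
    (hν : ContinuouslyDistributedOn ν univ) (t : ℝ) :
    transport hμ hν t = quantile μ (cdf ν t) := rfl

/-- Both distributions have the null sets of Lebesgue measure, so the rearrangement maps Lebesgue
null sets to Lebesgue null sets. -/
theorem map_transport_symm_absolutelyContinuous (hμ : ContinuouslyDistributedOn μ univ)
    (hν : ContinuouslyDistributedOn ν univ) :
    (volume : Measure ℝ).map (transport hμ hν).symm ≪ volume := by
  have hm : Measurable (transport hμ hν).symm := (transport hμ hν).symm.monotone.measurable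
  have h1 : μ.map (transport hμ hν).symm = ν := by
    have : IsFiniteMeasure (μ.map (transport hμ hν).symm) := by infer_instance
    refine Measure.ext_of_Iic _ _ fun t => ?_
    rw [Measure.map_apply hm measurableSet_Iic]
    have : (transport hμ hν).symm ⁻¹' Iic t = Iic (transport hμ hν t) := by
      ext u
      simp
    rw [this, ← ofReal_cdf μ, ← ofReal_cdf ν, transport_apply, cdf_quantile hμ (cdf_mem_Ioo hν t)]
  have h2 : (volume : Measure ℝ) ≪ μ := by simpa using hμ.2
  have h3 : ν ≪ volume := by simpa using hν.1
  exact (h2.map hm).trans (by rwa [h1])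

theorem map_symm_Ioo (G : ℝ ≃o ℝ) (a b : ℝ) :
    (volume : Measure ℝ).map G.symm (Ioo a b) = ENNReal.ofReal (G b - G a) := by
  rw [Measure.map_apply G.symm.monotone.measurable measurableSet_Ioo,
    OrderIso.preimage_Ioo, Real.volume_Ioo, OrderIso.symm_symm]

/-- An increasing homeomorphism of `ℝ` that preserves Lebesgue null sets and is locally affine
with slope `r` almost everywhere on an interval is affine on that interval. Without the first
property it could increase on a null set, as the Cantor function does. -/
theorem exists_affine_of_ae_locally_affine (G : ℝ ≃o ℝ)
    (hG : (volume : Measure ℝ).map G.symm ≪ volume) {r : ℝ} (hr : 0 ≤ r) {S : Set ℝ}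
    (hS : S.OrdConnected)
    (h : ∀ᵐ t ∂(volume.restrict S), ∃ c, ∀ᶠ u in 𝓝 t, G u = r * u + c) :
    ∃ c, ∀ t ∈ S, G t = r * t + c := by
  set lam := (volume : Measure ℝ).map G.symm with hlam
  let J := {q : ℚ × ℚ // ∃ c, ∀ u ∈ Icc (q.1 : ℝ) q.2, G u = r * u + c}
  let U : Set ℝ := ⋃ q : J, Ioo (q.1.1 : ℝ) q.1.2
  have hU : ∀ t, (∃ c, ∀ᶠ u in 𝓝 t, G u = r * u + c) → t ∈ U := by
    rintro t ⟨c, hc⟩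
    obtain ⟨a, b, ht, hab⟩ := mem_nhds_iff_exists_Ioo_subset.1 hc
    obtain ⟨a', ha1, ha2⟩ := exists_rat_btwn ht.1
    obtain ⟨b', hb1, hb2⟩ := exists_rat_btwn ht.2
    exact mem_iUnion.2 ⟨⟨(a', b'), c, fun u hu => hab ⟨ha1.trans_le hu.1, hu.2.trans_lt hb2⟩⟩,
      ha2, hb1⟩
  have hrest : lam.restrict U = (ENNReal.ofReal r • volume).restrict U := by
    refine Measure.restrict_iUnion_congr.2 ?_
    rintro ⟨⟨a, b⟩, c, hc⟩
    have hfin : IsFiniteMeasure (lam.restrict (Ioo (a : ℝ) b)) := by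
      refine ⟨?_⟩
      rw [Measure.restrict_apply_univ, map_symm_Ioo]
      exact ENNReal.ofReal_lt_top
    have hfin2 : IsFiniteMeasure ((ENNReal.ofReal r • volume).restrict (Ioo (a : ℝ) b)) := by
      refine ⟨?_⟩
      rw [Measure.restrict_apply_univ, Measure.smul_apply, Real.volume_Ioo]
      exact ENNReal.mul_lt_top ENNReal.ofReal_lt_top ENNReal.ofReal_lt_top
    refine Real.measure_ext_Ioo_rat fun a' b' => ?_
    simp only [Measure.restrict_apply measurableSet_Ioo, Ioo_inter_Ioo, map_symm_Ioo, hlam,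
      Measure.smul_apply, Real.volume_Ioo, smul_eq_mul]
    rw [← ENNReal.ofReal_mul hr]
    set x : ℝ := (a' : ℝ) ⊔ a
    set y : ℝ := (b' : ℝ) ⊓ b
    rcases le_total x y with hxy | hxy
    · have hx : x ∈ Icc (a : ℝ) b := ⟨le_sup_right, hxy.trans inf_le_right⟩
      have hy : y ∈ Icc (a : ℝ) b := ⟨le_sup_right.trans hxy, inf_le_right⟩
      rw [hc x hx, hc y hy]
      congr 1
      ring
    · rw [ENNReal.ofReal_of_nonpos (sub_nonpos.2 (G.monotone hxy)), ENNReal.ofReal_of_nonpos]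
      exact mul_nonpos_of_nonneg_of_nonpos hr (sub_nonpos.2 hxy)
  have hSU : ∀ᵐ t ∂(volume.restrict S), t ∈ U := h.mono fun t => hU t
  -- The complement of `U` in `S` is a null set for both measures.
  have hincr : ∀ s ∈ S, ∀ t ∈ S, s ≤ t → G t - G s = r * (t - s) := by
    intro s hs t ht hst
    have hsub : Ioo s t ⊆ S := Ioo_subset_Icc_self.trans (hS.out hs ht)
    have hnull : volume (Ioo s t \ U) = 0 := by
      have := ae_iff.1 (ae_restrict_of_ae_restrict_of_subset hsub hSU)
      rw [Measure.restrict_apply₀'] at this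
      · convert! this using 2
        ext; simp [and_comm]
      · exact measurableSet_Ioo.nullMeasurableSet
    have hUm : MeasurableSet U := MeasurableSet.iUnion fun _ => measurableSet_Ioo
    have e1 : lam (Ioo s t) = lam (Ioo s t ∩ U) := by
      rw [← measure_inter_add_sdiff _ hUm, hG hnull, add_zero]
    have e2 : volume (Ioo s t) = volume (Ioo s t ∩ U) := by
      rw [← measure_inter_add_sdiff _ hUm, hnull, add_zero]
    have e3 := congrArg (fun m => m (Ioo s t)) hrest
    simp only [Measure.restrict_apply measurableSet_Ioo, Measure.smul_apply] at e3
    rw [← e1, ← e2, hlam, map_symm_Ioo, Real.volume_Ioo, smul_eq_mul, ← ENNReal.ofReal_mul hr,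
      ENNReal.ofReal_eq_ofReal_iff (sub_nonneg.2 (G.monotone hst))
        (mul_nonneg hr (sub_nonneg.2 hst))] at e3
    exact e3
  rcases S.eq_empty_or_nonempty with rfl | ⟨s, hs⟩
  · exact ⟨0, by simp⟩
  · refine ⟨G s - r * s, fun t ht => ?_⟩
    rcases le_total s t with hst | hst
    · linarith [hincr s hs t ht hst]
    · linarith [hincr t ht s hs hst]

end Transport

/-! ### Identification of the coefficients of a single index -/

section SingleIndex

open Filter Topology

/-- `G` is affine with slope `r` near `t`. -/
def LocallyAffineAt (G : ℝ → ℝ) (r t : ℝ) : Prop := ∃ c, ∀ᶠ u in 𝓝 t, G u = r * u + c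

theorem measurableSet_locallyAffineAt (G : ℝ → ℝ) (r : ℝ) :
    MeasurableSet {t | LocallyAffineAt G r t} := by
  refine IsOpen.measurableSet (isOpen_iff_mem_nhds.2 ?_)
  rintro t ⟨c, hc⟩
  exact hc.eventually_nhds.mono fun u hu => ⟨c, hu⟩

theorem LocallyAffineAt.slope_pos {G : ℝ → ℝ} (hG : StrictMono G) {r t : ℝ}
    (h : LocallyAffineAt G r t) : 0 < r := by
  obtain ⟨c, hc⟩ := h
  obtain ⟨u, hu, htu⟩ := ((hc.filter_mono nhdsWithin_le_nhds).and
    (self_mem_nhdsWithin : Ioi t ∈ 𝓝[>] t)).exists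
  have h1 := hG htu
  rw [hu, hc.self_of_nhds] at h1
  have h2 : t < u := htu
  by_contra! hr
  nlinarith

theorem volume_diff_interior_of_ordConnected {I : Set ℝ} (hI : I.OrdConnected) :
    volume (I \ interior I) = 0 :=
  measure_mono_null (sdiff_subset_sdiff_left subset_closure)
    (hI.convex.addHaar_frontier volume)

theorem ContinuouslyDistributedOn.interior_nonempty {κ : Measure ℝ} [IsProbabilityMeasure κ]
    {I : Set ℝ} (hI : I.OrdConnected) (h : ContinuouslyDistributedOn κ I) :
    (interior I).Nonempty := by
  by_contra hne
  rw [not_nonempty_iff_eq_empty] at hne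
  have h0 := volume_diff_interior_of_ordConnected hI
  rw [hne, sdiff_empty] at h0
  have : κ univ = 0 := h.1 (by simpa using h0)
  simp at this

/-- If an affine function of `u` with nonzero slope is an increasing homeomorphic image of another
affine function of `u`, for almost every `u` in an interval, then the homeomorphism is affine with
the quotient of the slopes near almost every value it is applied to. -/
theorem locallyAffineAt_of_ae_eq (G : ℝ ≃o ℝ) {κ : Measure ℝ} [IsProbabilityMeasure κ]
    {I : Set ℝ} (hI : I.OrdConnected) (h : ContinuouslyDistributedOn κ I) {s a s' b : ℝ}
    (hs : s ≠ 0) (heq : ∀ᵐ u ∂κ, s * u + a = G (s' * u + b)) :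
    s' ≠ 0 ∧ ∀ᵐ u ∂κ, LocallyAffineAt G (s / s') (s' * u + b) := by
  have hGc : Continuous G := G.continuous
  have h1 : EqOn (fun u => s * u + a) (fun u => G (s' * u + b)) (interior I) := by
    refine Measure.eqOn_open_of_ae_eq (μ := volume) ?_ isOpen_interior (by fun_prop) (by fun_prop)
    exact ae_restrict_of_ae_restrict_of_subset interior_subset (h.2 heq)
  have hs' : s' ≠ 0 := by
    rintro rfl
    obtain ⟨u, hu⟩ := h.interior_nonempty hI
    have hI' : ∀ᶠ v in 𝓝[>] u, v ∈ interior I :=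
      mem_nhdsWithin_of_mem_nhds (isOpen_interior.mem_nhds hu)
    obtain ⟨v, hv, huv⟩ := (hI'.and self_mem_nhdsWithin).exists
    have e := (h1 hu).trans ((by simp : G (0 * u + b) = G (0 * v + b)).trans (h1 hv).symm)
    have : s * (v - u) = 0 := by simp only at e; linarith
    rcases mul_eq_zero.1 this with h | h
    · exact hs h
    · exact (sub_pos.2 huv).ne' h
  refine ⟨hs', ?_⟩
  have hint : ∀ᵐ u ∂κ, u ∈ interior I := by
    refine h.1 ?_
    have : volume (Iᶜ ∩ I ∪ I \ interior I) = 0 := by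
      rw [compl_inter_self, empty_union]
      exact volume_diff_interior_of_ordConnected hI
    refine mem_ae_iff.2 ?_
    rw [Measure.restrict_apply' hI.measurableSet]
    refine measure_mono_null ?_ this
    rintro x ⟨hx1, hx2⟩
    exact Or.inr ⟨hx2, hx1⟩
  filter_upwards [hint] with u hu
  refine ⟨a - s / s' * b, ?_⟩
  have hcont : Tendsto (fun t => (t - b) / s') (𝓝 (s' * u + b)) (𝓝 u) := by
    have : Continuous fun t : ℝ => (t - b) / s' := by fun_prop
    simpa [hs'] using this.tendsto (s' * u + b)
  filter_upwards [hcont.eventually (isOpen_interior.mem_nhds hu)] with t ht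
  have e := h1 ht
  simp only at e
  rw [mul_div_cancel₀ _ hs', sub_add_cancel] at e
  rw [← e]
  field_simp
  ring

variable {k k₀ k₁ : ℕ}

theorem eq_zero_of_ae_eq_zero {D : Measure (ℕ → Obs k)} [IsProbabilityMeasure D]
    {m : Coord k₀ k₁ → State k → ℝ} {j₀ : Coord k₀ k₁} (hm : IndexCondition D m j₀)
    {a : Coord k₀ k₁ → ℝ} (h : ∀ᵐ x ∂(stateLaw D), ∑ j, a j * m j x = 0) : a = 0 := by
  refine Matrix.eq_zero_of_mulVec_eq_zero hm.invertible.ne_zero ?_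
  ext i
  simp only [Matrix.mulVec, dotProduct, Matrix.of_apply, Pi.zero_apply]
  have hint : ∀ j, Integrable (fun x => m i x * m j x) (stateLaw D) := fun j =>
    (hm.memLp i).integrable_mul (hm.memLp j)
  simp_rw [← integral_mul_const]
  rw [← integral_finsetSum _ fun j _ => (hint j).mul_const _]
  refine integral_eq_zero_of_ae ?_
  filter_upwards [h] with x hx
  have : ∑ j, m i x * m j x * a j = m i x * ∑ j, a j * m j x := by
    rw [Finset.mul_sum]
    exact Finset.sum_congr rfl fun j _ => by ring
  rw [this, hx, mul_zero]
  rfl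

/-- If the choice probability is a continuous increasing function, with full support, of each of
the indices `θ·m` and `θ'·m`, then the normalized coefficients agree. -/
theorem eq_of_single_index {D : Measure (ℕ → Obs k)} [IsProbabilityMeasure D]
    {m : Coord k₀ k₁ → State k → ℝ} {j₀ : Coord k₀ k₁} (hm : IndexCondition D m j₀)
    {μ ν : Measure ℝ} [IsProbabilityMeasure μ] [IsProbabilityMeasure ν]
    (hμ : ContinuouslyDistributedOn μ univ) (hν : ContinuouslyDistributedOn ν univ)
    {θ θ' : EuclideanSpace ℝ (Coord k₀ k₁)} (hn : ‖θ‖ = 1) (hn' : ‖θ'‖ = 1) (hθ : θ j₀ ≠ 0)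
    {p : State k → ℝ} (hpm : Measurable p) {pl pu : ℝ}
    (hp : ContinuouslyDistributedOn ((stateLaw D).map p) (Icc pl pu))
    (hp01 : ∀ᵐ x ∂(stateLaw D), p x ∈ Ioo (0 : ℝ) 1 ∧ p x ∈ Icc pl pu)
    (hQ : ∀ᵐ x ∂(stateLaw D), quantile μ (p x) = ∑ j, θ j * m j x)
    (hQ' : ∀ᵐ x ∂(stateLaw D), quantile ν (p x) = ∑ j, θ' j * m j x) : θ = θ' := by
  classical
  set G := transport hμ hν with hG
  set P := stateLaw D with hP
  have hlink : ∀ᵐ x ∂P, ∑ j, θ j * m j x = G (∑ j, θ' j * m j x) := by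
    filter_upwards [hQ, hQ', hp01] with x h1 h2 h3
    rw [← h1, ← h2, hG, transport_apply, cdf_quantile hν h3.1]
  set mo : State k → ({j : Coord k₀ k₁ // j ≠ j₀} → ℝ) := fun x j => m j x with hmo
  have hmj : ∀ j, AEMeasurable (m j) P := fun j => (hm.memLp j).aestronglyMeasurable.aemeasurable
  have hmom : AEMeasurable mo P := aemeasurable_pi_lambda _ fun j => hmj j
  have hsplit : ∀ (a : EuclideanSpace ℝ (Coord k₀ k₁)) (x : State k), ∑ j, a j * m j x =
      a j₀ * m j₀ x + ∑ j : {j : Coord k₀ k₁ // j ≠ j₀}, a j * mo x j := by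
    intro a x
    rw [← Finset.add_sum_erase Finset.univ _ (Finset.mem_univ j₀)]
    congr 1
    rw [Finset.sum_subtype (p := fun j => j ≠ j₀)]
    simp
  let A : EuclideanSpace ℝ (Coord k₀ k₁) → ({j : Coord k₀ k₁ // j ≠ j₀} → ℝ) → ℝ :=
    fun a y => ∑ j : {j : Coord k₀ k₁ // j ≠ j₀}, a j * y j
  have hA : ∀ a, Measurable (A a) := fun a => by fun_prop
  set r := θ j₀ / θ' j₀ with hr
  have hGm : Measurable G := G.monotone.measurable
  have hpair : AEMeasurable (fun x => (mo x, m j₀ x)) P := hmom.prodMk (hmj j₀)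
  have hjoint : (P.map mo) ⊗ₘ condDistrib (m j₀) mo P = P.map fun x => (mo x, m j₀ x) :=
    compProd_map_condDistrib (hmj j₀)
  have hlink2 : ∀ᵐ z ∂((P.map mo) ⊗ₘ condDistrib (m j₀) mo P),
      θ j₀ * z.2 + A θ z.1 = G (θ' j₀ * z.2 + A θ' z.1) := by
    rw [hjoint, ae_map_iff hpair]
    · filter_upwards [hlink] with x hx
      rw [hsplit, hsplit] at hx
      exact hx
    · refine measurableSet_eq_fun ?_ (hGm.comp ?_)
      · exact (measurable_snd.const_mul _).add ((hA θ).comp measurable_fst)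
      · exact (measurable_snd.const_mul _).add ((hA θ').comp measurable_fst)
  have hlocal : ∀ᵐ y ∂(P.map mo), θ' j₀ ≠ 0 ∧
      ∀ᵐ u ∂(condDistrib (m j₀) mo P y), LocallyAffineAt G r (θ' j₀ * u + A θ' y) := by
    filter_upwards [Measure.ae_ae_of_ae_compProd hlink2, hm.continuous_coord] with y h1 h2
    obtain ⟨I, hI, hc⟩ := h2
    exact locallyAffineAt_of_ae_eq G hI hc hθ h1
  have hθ' : θ' j₀ ≠ 0 := by
    have : IsProbabilityMeasure (P.map mo) := Measure.isProbabilityMeasure_map hmom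
    exact hlocal.exists.choose_spec.1
  have hloc : ∀ᵐ x ∂P, LocallyAffineAt G r (quantile ν (p x)) := by
    have h1 : ∀ᵐ z ∂((P.map mo) ⊗ₘ condDistrib (m j₀) mo P),
        LocallyAffineAt G r (θ' j₀ * z.2 + A θ' z.1) := by
      refine Measure.ae_compProd_of_ae_ae ?_ (hlocal.mono fun y h => h.2)
      exact ((measurable_snd.const_mul _).add ((hA θ').comp measurable_fst))
        (measurableSet_locallyAffineAt G r)
    rw [hjoint] at h1
    filter_upwards [ae_of_ae_map hpair h1, hQ'] with x h1 h2
    rw [h2, hsplit]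
    exact h1
  have hrpos : 0 < r := hloc.exists.choose_spec.slope_pos G.strictMono
  -- `quantile ν (p x)` has the null sets of Lebesgue measure on the preimage of `[pl, pu]`.
  set S : Set ℝ := cdf ν ⁻¹' Icc pl pu with hS
  have hSord : S.OrdConnected := ordConnected_Icc.preimage_mono (monotone_cdf ν)
  have hSm : MeasurableSet S := hSord.measurableSet
  have hac : P.map p ≪ volume.restrict (Ioo (0 : ℝ) 1) := by
    have h1 : P.map p ≪ volume := hp.1.trans Measure.absolutelyContinuous_restrict
    have h2 : ∀ᵐ q ∂(P.map p), q ∈ Ioo (0 : ℝ) 1 :=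
      (ae_map_iff hpm.aemeasurable measurableSet_Ioo).2 (hp01.mono fun x h => h.1)
    rw [← Measure.restrict_eq_self_of_ae_mem h2]
    exact h1.restrict _
  have hqm : AEMeasurable (quantile ν) (P.map p) := (aemeasurable_quantile hν).mono_ac hac
  have hlocp : ∀ᵐ q ∂(P.map p), LocallyAffineAt G r (quantile ν q) := by
    refine ae_of_ae_map hqm ?_
    rw [AEMeasurable.map_map_of_aemeasurable hqm hpm.aemeasurable,
      ae_map_iff (hqm.comp_aemeasurable hpm.aemeasurable) (measurableSet_locallyAffineAt G r)]
    exact hloc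
  have hlocS : ∀ᵐ t ∂(volume.restrict S), LocallyAffineAt G r t := by
    rw [ae_restrict_iff' hSm]
    have h0 : ∀ᵐ t ∂ν, t ∈ S → LocallyAffineAt G r t := by
      rw [← map_quantile hν, ae_map_iff (aemeasurable_quantile hν)]
      · have h1 := (ae_restrict_iff' measurableSet_Icc).1 (hp.2 hlocp)
        filter_upwards [ae_restrict_of_ae h1, ae_restrict_mem measurableSet_Ioo] with q h1 h2 h3
        refine h1 ?_
        rwa [hS, mem_preimage, cdf_quantile hν h2] at h3
      · have : {t | t ∈ S → LocallyAffineAt G r t} = Sᶜ ∪ {t | LocallyAffineAt G r t} := by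
          ext t; simp [imp_iff_not_or]
        rw [this]
        exact hSm.compl.union (measurableSet_locallyAffineAt G r)
    have := hν.2
    rw [Measure.restrict_univ] at this
    exact this h0
  obtain ⟨c, hc⟩ := exists_affine_of_ae_locally_affine G
    (map_transport_symm_absolutelyContinuous hμ hν) hrpos.le hSord hlocS
  have hconst : ∀ᵐ x ∂P, ∑ j, (θ j - r * θ' j) * m j x = c := by
    filter_upwards [hlink, hQ', hp01] with x h1 h2 h3
    have h4 : (∑ j, θ' j * m j x) ∈ S := by
      rw [← h2, hS, mem_preimage, cdf_quantile hν h3.1]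
      exact h3.2
    rw [hc _ h4] at h1
    simp_rw [sub_mul, Finset.sum_sub_distrib, mul_assoc, ← Finset.mul_sum]
    linarith
  have hc0 := hm.no_constant _ _ hconst
  rw [hc0] at hconst
  have hzero := eq_zero_of_ae_eq_zero hm hconst
  have hθr : θ = r • θ' := by
    ext j
    have := congrFun hzero j
    simp only [Pi.zero_apply] at this
    simp only [PiLp.smul_apply, smul_eq_mul]
    linarith
  have hr1 : r = 1 := by
    have := congrArg norm hθr
    rw [norm_smul, hn, hn', mul_one, Real.norm_of_nonneg hrpos.le] at this
    exact this.symm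
  rw [hθr, hr1, one_smul]

end SingleIndex

/-! ### The choice probability as a propensity score -/

section Score

open scoped ENNReal

variable {k k₀ k₁ : ℕ} {D : Measure (ℕ → Obs k)} [IsProbabilityMeasure D] {pl pu : ℝ}

theorem measurable_choiceProb : Measurable (choiceProb D) :=
  (Kernel.measurable_coe _ (measurableSet_singleton true)).ennreal_toReal

theorem choiceProb_mem_Icc (x : State k) : choiceProb D x ∈ Icc (0 : ℝ) 1 :=
  ⟨measureReal_nonneg, measureReal_le_one⟩

instance : IsProbabilityMeasure ((stateLaw D).map (choiceProb D)) :=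
  Measure.isProbabilityMeasure_map measurable_choiceProb.aemeasurable

theorem stateLaw_map_choiceProb :
    (stateLaw D).map (choiceProb D) = D.map (fun ω => choiceProb D (ω 0).1) := by
  rw [stateLaw, Measure.map_map measurable_choiceProb (by fun_prop)]
  rfl

/-- The support of the choice probability is a nondegenerate subinterval of `[0, 1]`. -/
theorem ScoreInterval.bounds (hp : ScoreInterval D pl pu) : 0 ≤ pl ∧ pl < pu ∧ pu ≤ 1 := by
  have hlt : pl < pu := by
    by_contra! h
    have : (stateLaw D).map (choiceProb D) univ = 0 := hp.1 (by simp [h])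
    simp at this
  have h1 : ∀ᵐ q ∂((stateLaw D).map (choiceProb D)), q ∈ Icc (0 : ℝ) 1 :=
    (ae_map_iff measurable_choiceProb.aemeasurable measurableSet_Icc).2
      (Filter.Eventually.of_forall choiceProb_mem_Icc)
  have h2 : ∀ᵐ q ∂(volume.restrict (Icc pl pu)), q ∈ Icc (0 : ℝ) 1 := hp.2 h1
  have key : ∀ a b : ℝ, pl ≤ a → a < b → b ≤ pu → ∃ q ∈ Ioo a b, q ∈ Icc (0 : ℝ) 1 := by
    intro a b ha hab hb
    have h3 := ae_restrict_of_ae_restrict_of_subset (Ioo_subset_Icc_self.trans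
      (Icc_subset_Icc ha hb)) h2
    have hne : Filter.NeBot (ae (volume.restrict (Ioo a b))) := by
      rw [ae_neBot, Ne, Measure.restrict_eq_zero, Real.volume_Ioo]
      simp [hab]
    obtain ⟨q, hq1, hq2⟩ := ((ae_restrict_mem measurableSet_Ioo).and h3).exists
    exact ⟨q, hq1, hq2⟩
  refine ⟨?_, hlt, ?_⟩
  · by_contra! h
    obtain ⟨q, hq1, hq2⟩ := key pl (min pu 0) le_rfl (lt_min hlt h) (min_le_left _ _)
    exact absurd (hq1.2.trans_le (min_le_right _ _)) (not_lt.2 hq2.1)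
  · by_contra! h
    obtain ⟨q, hq1, hq2⟩ := key (max pl 1) pu (le_max_left _ _) (max_lt hlt h) le_rfl
    exact absurd ((le_max_right _ _).trans_lt hq1.1) (not_lt.2 hq2.2)

theorem ScoreInterval.ae_mem (hp : ScoreInterval D pl pu) :
    ∀ᵐ x ∂(stateLaw D), choiceProb D x ∈ Ioo (0 : ℝ) 1 ∧ choiceProb D x ∈ Icc pl pu := by
  refine ae_of_ae_map measurable_choiceProb.aemeasurable
    (p := fun q => q ∈ Ioo (0 : ℝ) 1 ∧ q ∈ Icc pl pu) (hp.1 ?_)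
  have hb := hp.bounds
  have hne : ∀ c : ℝ, ∀ᵐ q ∂(volume.restrict (Icc pl pu)), q ≠ c := fun c =>
    ae_restrict_of_ae (by simp [ae_iff])
  filter_upwards [ae_restrict_mem measurableSet_Icc, hne 0, hne 1] with q hq h0 h1
  exact ⟨⟨lt_of_le_of_ne (hb.1.trans hq.1) h0.symm, lt_of_le_of_ne (hq.2.trans hb.2.2) h1⟩, hq⟩

theorem ScoreInterval.ae_score_iff (hp : ScoreInterval D pl pu) {P : ℝ → Prop} :
    (∀ᵐ q ∂((stateLaw D).map (choiceProb D)), P q) ↔ ∀ᵐ q ∂(volume.restrict (Icc pl pu)), P q :=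
  ⟨fun h => hp.2 h, fun h => hp.1 h⟩

/-- The conditional probability of action `y` when the choice probability is `q`. -/
def actionWeight (q : ℝ) (y : Bool) : ℝ≥0∞ := ENNReal.ofReal (if y then q else 1 - q)

theorem measurable_actionWeight (y : Bool) : Measurable fun q => actionWeight q y := by
  unfold actionWeight
  cases y
  · simpa using (measurable_const.sub measurable_id).ennreal_ofReal
  · simpa using measurable_id.ennreal_ofReal

theorem actionWeight_pos {q : ℝ} (hq : q ∈ Ioo (0 : ℝ) 1) (y : Bool) : 0 < actionWeight q y := by
  rw [actionWeight, ENNReal.ofReal_pos]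
  cases y
  · simpa using hq.2
  · simpa using hq.1

theorem condDistrib_action_singleton (x : State k) (y : Bool) :
    condDistrib (fun ω : ℕ → Obs k => (ω 0).2) (fun ω => (ω 0).1) D x {y} =
      actionWeight (choiceProb D x) y := by
  set κ := condDistrib (fun ω : ℕ → Obs k => (ω 0).2) (fun ω => (ω 0).1) D
  have ht : κ x {true} = ENNReal.ofReal (choiceProb D x) := by
    rw [choiceProb, ofReal_measureReal]
  cases y
  · have : ({false} : Set Bool) = {true}ᶜ := by ext b; cases b <;> simp
    rw [this, prob_compl_eq_one_sub (measurableSet_singleton _), ht, actionWeight]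
    simp only [Bool.false_eq_true, if_false]
    rw [ENNReal.ofReal_sub _ (choiceProb_mem_Icc x).1, ENNReal.ofReal_one]
  · simp [ht, actionWeight]

theorem lintegral_obs_zero {f : Obs k → ℝ≥0∞} (hf : Measurable f) :
    ∫⁻ o, f o ∂(D.map fun ω => ω 0) =
      ∫⁻ x, ∑ y, actionWeight (choiceProb D x) y * f (x, y) ∂(stateLaw D) := by
  have h : (stateLaw D) ⊗ₘ condDistrib (fun ω : ℕ → Obs k => (ω 0).2) (fun ω => (ω 0).1) D =
      D.map (fun ω => ω 0) := compProd_map_condDistrib (Measurable.aemeasurable (by fun_prop))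
  rw [← h, Measure.lintegral_compProd hf]
  refine lintegral_congr fun x => ?_
  rw [lintegral_fintype]
  refine Finset.sum_congr rfl fun y _ => ?_
  rw [condDistrib_action_singleton, mul_comm]

/-- Where both actions have positive probability, what holds almost surely for `(X, Y)` holds for
almost every state together with each of the two actions. -/
theorem ScoreInterval.ae_forall_action (hp : ScoreInterval D pl pu) {P : Obs k → Prop}
    (h : ∀ᵐ o ∂(D.map fun ω => ω 0), P o) : ∀ᵐ x ∂(stateLaw D), ∀ y, P (x, y) := by
  obtain ⟨N, hN, hNm, hN0⟩ := exists_measurable_superset_of_null (ae_iff.1 h)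
  have h0 : ∫⁻ o, N.indicator 1 o ∂(D.map fun ω => ω 0) = 0 := by
    rw [lintegral_indicator_one hNm, hN0]
  rw [lintegral_obs_zero (measurable_one.indicator hNm), lintegral_eq_zero_iff] at h0
  · filter_upwards [h0, hp.ae_mem] with x hx hpx y
    by_contra hP
    have h1 := (Finset.sum_eq_zero_iff.1 hx) y (Finset.mem_univ y)
    rw [indicator_of_mem (hN hP), Pi.one_apply, mul_one] at h1
    exact (actionWeight_pos hpx.1 y).ne' h1
  · refine Finset.measurable_sum _ fun y _ => ?_
    exact ((measurable_actionWeight y).comp measurable_choiceProb).mul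
      ((measurable_one.indicator hNm).comp (by fun_prop))

theorem ScoreInterval.ae_score_forall_action (hp : ScoreInterval D pl pu) {P : ℝ × Bool → Prop}
    (h : ∀ᵐ q ∂(D.map fun ω => (choiceProb D (ω 0).1, (ω 0).2)), P q) :
    ∀ᵐ q ∂((stateLaw D).map (choiceProb D)), ∀ y, P (q, y) := by
  have hm := measurable_choiceProb (D := D)
  obtain ⟨N, hN, hNm, hN0⟩ := exists_measurable_superset_of_null (ae_iff.1 h)
  have h1 : ∀ᵐ q ∂(D.map fun ω => (choiceProb D (ω 0).1, (ω 0).2)), q ∉ N :=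
    measure_eq_zero_iff_ae_notMem.1 hN0
  have h2 : ∀ᵐ o ∂(D.map fun ω => ω 0), (choiceProb D o.1, o.2) ∉ N := by
    have e : D.map (fun ω => (choiceProb D (ω 0).1, (ω 0).2)) =
        (D.map fun ω => ω 0).map fun o => (choiceProb D o.1, o.2) := by
      rw [Measure.map_map (by fun_prop) (by fun_prop)]
      rfl
    rw [e] at h1
    exact ae_of_ae_map (p := fun q => q ∉ N) (by fun_prop) h1
  have h3 : ∀ᵐ q ∂((stateLaw D).map (choiceProb D)), ∀ y, (q, y) ∉ N := by
    rw [ae_map_iff hm.aemeasurable]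
    · exact hp.ae_forall_action h2
    · simp only [ofPred_forall]
      exact MeasurableSet.iInter fun y =>
        (hNm.preimage (measurable_id.prodMk measurable_const)).compl
  filter_upwards [h3] with q hq y
  by_contra hP
  exact hq y (hN hP)

/-! ### Averaging over states with the same choice probability -/

/-- The conditional distribution of the state given the choice probability. -/
def levelKernel (D : Measure (ℕ → Obs k)) [IsProbabilityMeasure D] : Kernel ℝ (State k) :=
  condDistrib (fun ω : ℕ → Obs k => (ω 0).1) (fun ω => choiceProb D (ω 0).1) D

/-- The conditional distribution of `(X_s, Y_s)` given `(X_0, Y_0)`. -/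
def obsKernel (D : Measure (ℕ → Obs k)) [IsProbabilityMeasure D] (s : ℕ) :
    Kernel (Obs k) (Obs k) :=
  condDistrib (fun ω : ℕ → Obs k => ω s) (fun ω => ω 0) D

instance : IsMarkovKernel (levelKernel D) := by unfold levelKernel; infer_instance

instance (s : ℕ) : IsMarkovKernel (obsKernel D s) := by unfold obsKernel; infer_instance

instance (s : ℕ) : IsMarkovKernel (scoreKernel D s) := by unfold scoreKernel; infer_instance

theorem score_compProd_levelKernel :
    ((stateLaw D).map (choiceProb D)) ⊗ₘ levelKernel D =
      (stateLaw D).map fun x => (choiceProb D x, x) := by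
  have hm := measurable_choiceProb (D := D)
  rw [stateLaw_map_choiceProb, levelKernel, compProd_map_condDistrib
    (Measurable.aemeasurable (by fun_prop)), stateLaw,
    Measure.map_map (by fun_prop) (by fun_prop)]
  rfl

theorem ae_levelKernel {P : State k → Prop} (h : ∀ᵐ x ∂(stateLaw D), P x) :
    ∀ᵐ q ∂((stateLaw D).map (choiceProb D)), ∀ᵐ x ∂(levelKernel D q), P x ∧ choiceProb D x = q := by
  have hm := measurable_choiceProb (D := D)
  obtain ⟨N, hN, hNm, hN0⟩ := exists_measurable_superset_of_null (ae_iff.1 h)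
  have h1 : ∀ᵐ z ∂(((stateLaw D).map (choiceProb D)) ⊗ₘ levelKernel D),
      z.2 ∉ N ∧ choiceProb D z.2 = z.1 := by
    rw [score_compProd_levelKernel, ae_map_iff (by fun_prop)]
    · filter_upwards [measure_eq_zero_iff_ae_notMem.1 hN0] with x hx
      exact ⟨hx, rfl⟩
    · exact (hNm.preimage measurable_snd).compl.inter
        (measurableSet_eq_fun (hm.comp measurable_snd) measurable_fst)
  filter_upwards [Measure.ae_ae_of_ae_compProd h1] with q hq
  filter_upwards [hq] with x hx
  exact ⟨not_not.1 fun hP => hx.1 (hN hP), hx.2⟩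

/-- Law of `p(X_s)` given `p(X_0) = q` and `Y_0 = y`, computed by averaging over the states with
choice probability `q`. -/
def averagedKernel (D : Measure (ℕ → Obs k)) [IsProbabilityMeasure D] (s : ℕ) :
    Kernel (ℝ × Bool) ℝ :=
  ((obsKernel D s).map fun o => choiceProb D o.1) ∘ₖ (levelKernel D ∥ₖ Kernel.id)

theorem lintegral_averagedKernel (s : ℕ) (q : ℝ) (y : Bool) {g : ℝ → ℝ≥0∞} (hg : Measurable g) :
    ∫⁻ u, g u ∂(averagedKernel D s (q, y)) =
      ∫⁻ x, ∫⁻ o, g (choiceProb D o.1) ∂(obsKernel D s (x, y)) ∂(levelKernel D q) := by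
  have hm := measurable_choiceProb (D := D)
  rw [averagedKernel, Kernel.lintegral_comp _ _ _ hg, Kernel.lintegral_parallelComp]
  · refine lintegral_congr fun x => ?_
    rw [Kernel.lintegral_id', Kernel.lintegral_map _ (by fun_prop) _ hg]
    exact (hg.lintegral_kernel (κ := (obsKernel D s).map fun o => choiceProb D o.1)).comp
      measurable_prodMk_left
  · exact hg.lintegral_kernel

instance (s : ℕ) : IsMarkovKernel (averagedKernel D s) := by
  have hm := measurable_choiceProb (D := D)
  have : IsMarkovKernel ((obsKernel D s).map fun o => choiceProb D o.1) :=
    Kernel.IsMarkovKernel.map _ (by fun_prop)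
  unfold averagedKernel
  infer_instance

theorem lintegral_score_compProd {f : ℝ × State k → ℝ≥0∞} (hf : Measurable f) :
    ∫⁻ q, ∫⁻ x, f (q, x) ∂(levelKernel D q) ∂((stateLaw D).map (choiceProb D)) =
      ∫⁻ x, f (choiceProb D x, x) ∂(stateLaw D) := by
  have hm := measurable_choiceProb (D := D)
  rw [← Measure.lintegral_compProd hf, score_compProd_levelKernel,
    lintegral_map hf (by fun_prop)]

theorem map_obs_eq_compProd (s : ℕ) :
    D.map (fun ω => (ω 0, ω s)) = (D.map fun ω => ω 0) ⊗ₘ obsKernel D s :=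
  (compProd_map_condDistrib (Measurable.aemeasurable (by fun_prop))).symm

/-- Given the choice probability, the action is independent of the state, so conditioning on
`(p(X), Y)` amounts to averaging over the states with the given choice probability. -/
theorem map_score_eq_compProd (s : ℕ) :
    D.map (fun ω => ((choiceProb D (ω 0).1, (ω 0).2), choiceProb D (ω s).1)) =
      (D.map fun ω => (choiceProb D (ω 0).1, (ω 0).2)) ⊗ₘ averagedKernel D s := by
  have hm := measurable_choiceProb (D := D)
  refine Measure.ext_of_lintegral _ fun f hf => ?_
  let H : Bool → ℝ × State k → ℝ≥0∞ := fun y z =>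
    ∫⁻ o, f ((z.1, y), choiceProb D o.1) ∂(obsKernel D s (z.2, y))
  have hH : ∀ y, Measurable (H y) := by
    intro y
    have : Measurable (fun z : ℝ × State k => (z.2, y)) := by fun_prop
    refine Measurable.lintegral_kernel_prod_right'
      (κ := (obsKernel D s).comap (fun z : ℝ × State k => (z.2, y)) this)
      (f := fun z => f ((z.1.1, y), choiceProb D z.2.1)) ?_
    fun_prop
  have hK : Measurable fun z => ∫⁻ u, f (z, u) ∂(averagedKernel D s z) :=
    hf.lintegral_kernel_prod_right'
  have hK' : Measurable fun o : Obs k => ∫⁻ u, f ((choiceProb D o.1, o.2), u)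
      ∂(averagedKernel D s (choiceProb D o.1, o.2)) :=
    hK.comp (by fun_prop : Measurable fun o : Obs k => (choiceProb D o.1, o.2))
  have hwm : ∀ y, Measurable fun q => actionWeight q y := measurable_actionWeight
  have lhs : ∫⁻ z, f z ∂(D.map fun ω => ((choiceProb D (ω 0).1, (ω 0).2), choiceProb D (ω s).1)) =
      ∫⁻ x, ∑ y, actionWeight (choiceProb D x) y * H y (choiceProb D x, x) ∂(stateLaw D) := by
    have hf' : Measurable fun z : Obs k × Obs k => f ((choiceProb D z.1.1, z.1.2),
      choiceProb D z.2.1) := by fun_prop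
    rw [lintegral_map hf (by fun_prop), ← lintegral_map (f := fun z : Obs k × Obs k =>
      f ((choiceProb D z.1.1, z.1.2), choiceProb D z.2.1)) (g := fun ω : ℕ → Obs k => (ω 0, ω s))
      hf' (by fun_prop), map_obs_eq_compProd, Measure.lintegral_compProd hf',
      lintegral_obs_zero hf'.lintegral_kernel_prod_right']
  have rhs : ∫⁻ z, f z ∂((D.map fun ω => (choiceProb D (ω 0).1, (ω 0).2)) ⊗ₘ averagedKernel D s) =
      ∫⁻ x, ∑ y, actionWeight (choiceProb D x) y *
        ∫⁻ u, f ((choiceProb D x, y), u) ∂(averagedKernel D s (choiceProb D x, y))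
          ∂(stateLaw D) := by
    rw [Measure.lintegral_compProd hf, lintegral_map hK (by fun_prop),
      ← lintegral_map (f := fun o : Obs k => ∫⁻ u, f ((choiceProb D o.1, o.2), u)
        ∂(averagedKernel D s (choiceProb D o.1, o.2))) (g := fun ω : ℕ → Obs k => ω 0)
        hK' (by fun_prop),
      lintegral_obs_zero hK']
  have hS : Measurable fun z : ℝ × State k => ∑ y, actionWeight z.1 y * H y z :=
    Finset.measurable_sum _ fun y _ => ((hwm y).comp measurable_fst).mul (hH y)
  have hT : Measurable fun q : ℝ => ∑ y, actionWeight q y *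
      ∫⁻ u, f ((q, y), u) ∂(averagedKernel D s (q, y)) :=
    Finset.measurable_sum _ fun y _ => (hwm y).mul (hK.comp (by fun_prop))
  rw [lhs, rhs, ← lintegral_score_compProd hS, ← lintegral_map hT hm]
  refine lintegral_congr fun q => ?_
  rw [lintegral_finsetSum (f := fun y x => actionWeight q y * H y (q, x)) _ fun y _ =>
    ((hH y).comp measurable_prodMk_left).const_mul _]
  refine Finset.sum_congr rfl fun y _ => ?_
  have hHq : Measurable fun x => H y (q, x) := (hH y).comp measurable_prodMk_left
  rw [lintegral_const_mul _ hHq,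
    lintegral_averagedKernel s q y (g := fun u => f ((q, y), u)) (by fun_prop)]

theorem ScoreInterval.ae_scoreKernel_eq (hp : ScoreInterval D pl pu) :
    ∀ᵐ q ∂((stateLaw D).map (choiceProb D)), ∀ s y,
      scoreKernel D s (q, y) = averagedKernel D s (q, y) := by
  have hm := measurable_choiceProb (D := D)
  refine ae_all_iff.2 fun s => hp.ae_score_forall_action
    (P := fun z => scoreKernel D s z = averagedKernel D s z) ?_
  exact condDistrib_ae_eq_of_measure_eq_compProd_of_measurable (by fun_prop) (by fun_prop)
    (map_score_eq_compProd s)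

end Score

/-! ### Discounted differences of expectations -/

section DiscountedDiff

variable {α : Type*} [MeasurableSpace α]

/-- `∑_{s ≥ 1} β^s (∫ f dκ_s(1) - ∫ f dκ_s(0))` for a pair of sequences of distributions. -/
def discountedDiff (β : ℝ) (κ : ℕ → Bool → Measure α) (f : α → ℝ) : ℝ :=
  ∑' s : ℕ, β ^ (s + 1) * ((∫ o, f o ∂(κ s true)) - ∫ o, f o ∂(κ s false))

variable {β : ℝ} {κ : ℕ → Bool → Measure α}

theorem discountedDiff_congr {f g : α → ℝ} (h : ∀ s y, f =ᵐ[κ s y] g) :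
    discountedDiff β κ f = discountedDiff β κ g := by
  unfold discountedDiff
  congr 1 with s
  rw [integral_congr_ae (h s true), integral_congr_ae (h s false)]

theorem abs_integral_le_of_abs_le {ρ : Measure α} [IsProbabilityMeasure ρ] {f : α → ℝ} {C : ℝ}
    (h : ∀ a, |f a| ≤ C) : |∫ a, f a ∂ρ| ≤ C := by
  have := norm_integral_le_of_norm_le_const (μ := ρ) (f := f) (C := C)
    (Filter.Eventually.of_forall h)
  simpa using this

theorem integrable_of_abs_le {ρ : Measure α} [IsFiniteMeasure ρ] {f : α → ℝ} {C : ℝ}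
    (hf : Measurable f) (h : ∀ a, |f a| ≤ C) : Integrable f ρ :=
  Integrable.of_bound hf.aestronglyMeasurable C (Filter.Eventually.of_forall h)

theorem summable_discount (hβ : β ∈ Ioo (0 : ℝ) 1) (C : ℝ) :
    Summable fun s : ℕ => β ^ (s + 1) * C :=
  ((summable_nat_add_iff 1).2 (summable_geometric_of_lt_one hβ.1.le hβ.2)).mul_right C

theorem summable_discountedDiff (hβ : β ∈ Ioo (0 : ℝ) 1) [∀ s y, IsProbabilityMeasure (κ s y)]
    {f : α → ℝ} {C : ℝ} (h : ∀ a, |f a| ≤ C) :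
    Summable fun s : ℕ => β ^ (s + 1) * ((∫ o, f o ∂(κ s true)) - ∫ o, f o ∂(κ s false)) := by
  refine Summable.of_norm_bounded (summable_discount hβ (2 * C)) fun s => ?_
  rw [norm_mul, Real.norm_eq_abs, abs_of_nonneg (pow_nonneg hβ.1.le _)]
  refine mul_le_mul_of_nonneg_left ?_ (pow_nonneg hβ.1.le _)
  refine (norm_sub_le _ _).trans ?_
  rw [two_mul]
  exact add_le_add (abs_integral_le_of_abs_le h) (abs_integral_le_of_abs_le h)

theorem discountedDiff_sum (hβ : β ∈ Ioo (0 : ℝ) 1) [∀ s y, IsProbabilityMeasure (κ s y)]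
    {ι : Type*} [Fintype ι] {f : ι → α → ℝ} {C : ι → ℝ} (hf : ∀ i, Measurable (f i))
    (h : ∀ i a, |f i a| ≤ C i) (c : ι → ℝ) :
    discountedDiff β κ (fun a => ∑ i, c i * f i a) = ∑ i, c i * discountedDiff β κ (f i) := by
  unfold discountedDiff
  simp_rw [← tsum_mul_left]
  rw [← Summable.tsum_finsetSum fun i _ => (summable_discountedDiff hβ (h i)).mul_left (c i)]
  congr 1 with s
  have e : ∀ y, ∫ a, ∑ i, c i * f i a ∂(κ s y) = ∑ i, c i * ∫ a, f i a ∂(κ s y) := by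
    intro y
    rw [integral_finsetSum _ fun i _ => (integrable_of_abs_le (hf i) (h i)).const_mul _]
    simp_rw [integral_const_mul]
  rw [e, e, ← Finset.sum_sub_distrib, Finset.mul_sum]
  exact Finset.sum_congr rfl fun i _ => by ring

theorem discountedDiff_sub (hβ : β ∈ Ioo (0 : ℝ) 1) [∀ s y, IsProbabilityMeasure (κ s y)]
    {f g : α → ℝ} {C C' : ℝ} (hf : Measurable f) (hg : Measurable g)
    (hfC : ∀ a, |f a| ≤ C) (hgC : ∀ a, |g a| ≤ C') :
    discountedDiff β κ (fun a => f a - g a) = discountedDiff β κ f - discountedDiff β κ g := by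
  unfold discountedDiff
  rw [← (summable_discountedDiff hβ hfC).tsum_sub (summable_discountedDiff hβ hgC)]
  congr 1 with s
  rw [integral_sub (integrable_of_abs_le hf hfC) (integrable_of_abs_le hg hgC),
    integral_sub (integrable_of_abs_le hf hfC) (integrable_of_abs_le hg hgC)]
  ring

end DiscountedDiff

/-! ### Primitives on the support of the choice probability -/

section Primitive

variable {pl pu : ℝ} {h : ℝ → ℝ}

/-- The primitive of `h` on `[pl, pu]`, extended to a bounded continuous function on `ℝ`. -/
def primitive (pl pu : ℝ) (h : ℝ → ℝ) (q : ℝ) : ℝ := ∫ τ in pl..q, (Icc pl pu).indicator h τ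

theorem primitive_eq {q : ℝ} (hq : q ∈ Icc pl pu) : primitive pl pu h q = ∫ τ in pl..q, h τ := by
  refine intervalIntegral.integral_congr fun τ hτ => ?_
  rw [uIcc_of_le hq.1] at hτ
  exact indicator_of_mem (Icc_subset_Icc_right hq.2 hτ) h

theorem continuous_primitive_Icc (hh : IntegrableOn h (Icc pl pu)) :
    Continuous (primitive pl pu h) := by
  have hi : Integrable ((Icc pl pu).indicator h) := hh.integrable_indicator measurableSet_Icc
  exact intervalIntegral.continuous_primitive (fun a b => hi.intervalIntegrable) pl

theorem abs_primitive_le (hh : IntegrableOn h (Icc pl pu)) (q : ℝ) :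
    |primitive pl pu h q| ≤ ∫ τ in Icc pl pu, |h τ| := by
  have hi : Integrable ((Icc pl pu).indicator h) := hh.integrable_indicator measurableSet_Icc
  rw [primitive, ← Real.norm_eq_abs]
  refine intervalIntegral.norm_integral_le_integral_norm_uIoc.trans ?_
  refine (setIntegral_le_integral hi.norm (Filter.Eventually.of_forall fun _ => norm_nonneg _)).trans
    (le_of_eq ?_)
  rw [← integral_indicator measurableSet_Icc]
  congr 1 with τ
  by_cases hτ : τ ∈ Icc pl pu <;> simp [hτ]

theorem primitive_eq_setIntegral {q : ℝ} (hq : q ∈ Icc pl pu) :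
    primitive pl pu h q = ∫ τ in Icc pl pu, (Iio q).indicator h τ := by
  have e : Icc pl pu ∩ Iio q = Ico pl q := by
    ext τ
    exact ⟨fun h => ⟨h.1.1, h.2⟩, fun h => ⟨⟨h.1, h.2.le.trans hq.2⟩, h.2⟩⟩
  rw [primitive_eq hq, intervalIntegral.integral_of_le hq.1, integral_Ioc_eq_integral_Ioo,
    setIntegral_indicator measurableSet_Iio, e, integral_Ico_eq_integral_Ioo]

/-- Integration by parts against the distribution function of `ρ`. -/
theorem integral_primitive {ρ : Measure ℝ} [IsProbabilityMeasure ρ]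
    (hρ : ∀ᵐ q ∂ρ, q ∈ Icc pl pu) (hh : IntegrableOn h (Icc pl pu)) :
    ∫ q, primitive pl pu h q ∂ρ = ∫ τ in Icc pl pu, h τ * (1 - ρ.real (Iic τ)) := by
  have h1 : ∫ q, primitive pl pu h q ∂ρ =
      ∫ q, (∫ τ in Icc pl pu, (Iio q).indicator h τ) ∂ρ :=
    integral_congr_ae (hρ.mono fun q hq => primitive_eq_setIntegral (h := h) hq)
  have hm : MeasurableSet {z : ℝ × ℝ | z.2 < z.1} := measurableSet_lt measurable_snd measurable_fst
  have hint : Integrable (Function.uncurry fun q τ => (Iio q).indicator h τ)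
      (ρ.prod (volume.restrict (Icc pl pu))) := by
    have : (Function.uncurry fun q τ => (Iio q).indicator h τ) =
        {z : ℝ × ℝ | z.2 < z.1}.indicator fun z => h z.2 := by
      ext ⟨q, τ⟩
      simp [indicator]
    rw [this]
    exact (Integrable.comp_snd hh ρ).indicator hm
  rw [h1, integral_integral_swap hint]
  congr 1 with τ
  have e : (fun q => (Iio q).indicator h τ) = (Ioi τ).indicator fun _ => h τ := by
    ext q
    simp [indicator]
  rw [e, integral_indicator_const _ measurableSet_Ioi, smul_eq_mul, mul_comm, ← compl_Iic,
    probReal_compl_eq_one_sub measurableSet_Iic]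

end Primitive

/-! ### The integral equation on the support of the choice probability -/

section IntegralEquation

variable {k k₀ k₁ : ℕ} {D : Measure (ℕ → Obs k)} [IsProbabilityMeasure D] {pl pu β : ℝ}

theorem stateDiff_eq_discountedDiff (f : Obs k → ℝ) (x : State k) :
    stateDiff D β f x = discountedDiff β (fun s y => obsKernel D (s + 1) (x, y)) f := rfl

theorem scoreDiff_eq_discountedDiff (g : ℝ → ℝ) (q : ℝ) :
    scoreDiff D β g q = discountedDiff β (fun s y => scoreKernel D (s + 1) (q, y)) g := rfl

/-- Under stationarity, what holds almost surely for `X` holds for `X_s` given almost every initial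
state and either action. -/
theorem ScoreInterval.ae_obsKernel (hp : ScoreInterval D pl pu)
    (hst : ∀ s, D.map (fun ω => (ω s).1) = stateLaw D) {P : State k → Prop}
    (h : ∀ᵐ x ∂(stateLaw D), P x) :
    ∀ᵐ x ∂(stateLaw D), ∀ s y, ∀ᵐ o ∂(obsKernel D s (x, y)), P o.1 := by
  refine ae_all_iff.2 fun s => hp.ae_forall_action
    (P := fun z => ∀ᵐ o ∂(obsKernel D s z), P o.1) ?_
  obtain ⟨N, hN, hNm, hN0⟩ := exists_measurable_superset_of_null (ae_iff.1 h)
  have h1 : ∀ᵐ z ∂((D.map fun ω => ω 0) ⊗ₘ obsKernel D s), z.2.1 ∉ N := by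
    rw [← map_obs_eq_compProd, ae_map_iff (p := fun z : Obs k × Obs k => z.2.1 ∉ N)
      (Measurable.aemeasurable (by fun_prop : Measurable fun ω : ℕ → Obs k => (ω 0, ω s)))
      (hNm.preimage (by fun_prop : Measurable fun z : Obs k × Obs k => z.2.1)).compl]
    rw [← hst s] at hN0
    exact ae_of_ae_map (p := fun x => x ∉ N) (Measurable.aemeasurable (by fun_prop))
      (measure_eq_zero_iff_ae_notMem.1 hN0)
  filter_upwards [Measure.ae_ae_of_ae_compProd h1] with z hz
  filter_upwards [hz] with o ho
  exact not_not.1 fun hP => ho (hN hP)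

theorem ScoreInterval.ae_scoreKernel_mem (hp : ScoreInterval D pl pu)
    (hst : ∀ s, D.map (fun ω => (ω s).1) = stateLaw D) :
    ∀ᵐ q ∂(volume.restrict (Icc pl pu)), ∀ s y, ∀ᵐ u ∂(scoreKernel D s (q, y)), u ∈ Icc pl pu := by
  have hm := measurable_choiceProb (D := D)
  refine hp.ae_score_iff.1 (ae_all_iff.2 fun s => hp.ae_score_forall_action
    (P := fun z => ∀ᵐ u ∂(scoreKernel D s z), u ∈ Icc pl pu) ?_)
  have h1 : ∀ᵐ z ∂((D.map fun ω => (choiceProb D (ω 0).1, (ω 0).2)) ⊗ₘ scoreKernel D s),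
      z.2 ∈ Icc pl pu := by
    rw [scoreKernel, compProd_map_condDistrib (Measurable.aemeasurable (by fun_prop)),
      ae_map_iff (Measurable.aemeasurable (by fun_prop)) (measurableSet_Icc.preimage measurable_snd)]
    have h2 := hp.ae_mem
    rw [← hst s] at h2
    exact (ae_of_ae_map (p := fun x => choiceProb D x ∈ Ioo (0 : ℝ) 1 ∧ choiceProb D x ∈ Icc pl pu)
      (Measurable.aemeasurable (by fun_prop)) h2).mono fun ω h => h.2
  exact Measure.ae_ae_of_ae_compProd h1

/-- Averaging over the states with a given choice probability turns differences given `X` into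
differences given `p(X)`. -/
theorem ScoreInterval.ae_scoreDiff_eq_integral (hp : ScoreInterval D pl pu)
    (hβ : β ∈ Ioo (0 : ℝ) 1) {g : ℝ → ℝ} (hg : Measurable g) {C : ℝ} (hC : ∀ u, |g u| ≤ C) :
    ∀ᵐ q ∂((stateLaw D).map (choiceProb D)), scoreDiff D β g q =
      ∫ x, stateDiff D β (fun o => g (choiceProb D o.1)) x ∂(levelKernel D q) := by
  have hm := measurable_choiceProb (D := D)
  have hgm : Measurable fun o : Obs k => g (choiceProb D o.1) := by fun_prop
  filter_upwards [hp.ae_scoreKernel_eq] with q hq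
  have hinner : ∀ s y, Measurable fun x =>
      ∫ o, g (choiceProb D o.1) ∂(obsKernel D s (x, y)) := by
    intro s y
    have : StronglyMeasurable fun z => ∫ o, g (choiceProb D o.1) ∂(obsKernel D s z) :=
      hgm.stronglyMeasurable.integral_kernel
    exact this.measurable.comp (by fun_prop : Measurable fun x : State k => (x, y))
  have hbound : ∀ s y x, |∫ o, g (choiceProb D o.1) ∂(obsKernel D s (x, y))| ≤ C :=
    fun s y x => abs_integral_le_of_abs_le fun o => hC _
  have havg : ∀ s y, ∫ u, g u ∂(scoreKernel D s (q, y)) =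
      ∫ x, ∫ o, g (choiceProb D o.1) ∂(obsKernel D s (x, y)) ∂(levelKernel D q) := by
    intro s y
    rw [hq s y, averagedKernel, Kernel.integral_comp]
    · rw [Kernel.parallelComp_apply, Kernel.id_apply, Measure.prod_dirac, integral_map]
      · refine integral_congr_ae (Filter.Eventually.of_forall fun x => ?_)
        simp only
        rw [Kernel.map_apply _ (by fun_prop), integral_map (Measurable.aemeasurable (by fun_prop))
          hg.aestronglyMeasurable]
      · exact Measurable.aemeasurable (by fun_prop)
      · exact hg.stronglyMeasurable.integral_kernel.aestronglyMeasurable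
    · have : IsMarkovKernel ((obsKernel D s).map fun o => choiceProb D o.1) :=
        Kernel.IsMarkovKernel.map _ (by fun_prop)
      exact integrable_of_abs_le hg hC
  unfold scoreDiff stateDiff
  have hint : ∀ s y, Integrable (fun x => ∫ o, g (choiceProb D o.1) ∂(obsKernel D s (x, y)))
    (levelKernel D q) := fun s y => integrable_of_abs_le (hinner s y) (hbound s y)
  have hswap := integral_tsum_of_summable_integral_norm (μ := levelKernel D q)
    (F := fun s x => β ^ (s + 1) * ((∫ o, g (choiceProb D o.1) ∂(obsKernel D (s + 1) (x, true))) -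
      ∫ o, g (choiceProb D o.1) ∂(obsKernel D (s + 1) (x, false))))
    (fun s => ((hint _ _).sub (hint _ _)).const_mul _) ?_
  · refine Eq.trans (tsum_congr fun s => ?_) hswap
    rw [integral_const_mul, integral_sub (hint _ _) (hint _ _), havg, havg]
  · refine Summable.of_nonneg_of_le (fun s => integral_nonneg fun _ => norm_nonneg _) (fun s => ?_)
      (summable_discount hβ (2 * C))
    have hb : ∀ x, ‖β ^ (s + 1) * ((∫ o, g (choiceProb D o.1) ∂(obsKernel D (s + 1) (x, true))) -
        ∫ o, g (choiceProb D o.1) ∂(obsKernel D (s + 1) (x, false)))‖ ≤ β ^ (s + 1) * (2 * C) := by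
      intro x
      rw [norm_mul, Real.norm_eq_abs, abs_of_nonneg (pow_nonneg hβ.1.le _)]
      refine mul_le_mul_of_nonneg_left ?_ (pow_nonneg hβ.1.le _)
      refine (norm_sub_le _ _).trans ?_
      rw [two_mul]
      exact add_le_add (hbound _ _ _) (hbound _ _ _)
    have := norm_integral_le_of_norm_le_const (μ := levelKernel D q)
      (f := fun x => ‖β ^ (s + 1) * ((∫ o, g (choiceProb D o.1) ∂(obsKernel D (s + 1) (x, true))) -
        ∫ o, g (choiceProb D o.1) ∂(obsKernel D (s + 1) (x, false)))‖)
      (Filter.Eventually.of_forall fun x => by rw [norm_norm]; exact hb x)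
    rw [probReal_univ, mul_one] at this
    exact (le_abs_self _).trans this

theorem measurable_bigPi : Measurable fun z : ℝ × ℝ => bigPi D β z.1 z.2 := by
  have hF : ∀ s y, Measurable fun z : ℝ × ℝ => (scoreKernel D s (z.2, y)).real (Iic z.1) := by
    intro s y
    have hc : Measurable (fun z : ℝ × ℝ => (z.2, y)) := by fun_prop
    have ht : MeasurableSet {w : (ℝ × ℝ) × ℝ | w.2 ≤ w.1.1} :=
      measurableSet_le measurable_snd (measurable_fst.comp measurable_fst)
    exact (Kernel.measurable_kernel_prodMk_left (κ := (scoreKernel D s).comap _ hc) ht).ennreal_toReal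
  unfold bigPi
  exact Measurable.tsum fun s => ((hF _ _).sub (hF _ _)).const_mul _

theorem measurable_integral_sq {F : ℝ → ℝ → ℝ} (hF : Measurable fun z : ℝ × ℝ => F z.1 z.2)
    (ρ : Measure ℝ) [SFinite ρ] : Measurable fun q => ∫ τ, F τ q ^ 2 ∂ρ := by
  have h : StronglyMeasurable (fun z : ℝ × ℝ => F z.2 z.1 ^ 2) :=
    ((hF.comp measurable_swap).pow_const 2).stronglyMeasurable
  exact h.integral_prod_right.measurable

theorem measurable_bigPi_left (q : ℝ) : Measurable fun τ => bigPi D β τ q := by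
  have h1 := measurable_bigPi (D := D) (β := β)
  have h2 : Measurable fun τ : ℝ => (τ, q) := by fun_prop
  have h3 := h1.comp h2
  exact h3

theorem abs_cdf_diff_le_one (s : ℕ) (q p : ℝ) : |(scoreKernel D s (p, true)).real (Iic q) -
    (scoreKernel D s (p, false)).real (Iic q)| ≤ 1 := by
  rw [abs_sub_le_iff]
  constructor
  · linarith [measureReal_le_one (μ := scoreKernel D s (p, true)) (s := Iic q),
      measureReal_nonneg (μ := scoreKernel D s (p, false)) (s := Iic q)]
  · linarith [measureReal_le_one (μ := scoreKernel D s (p, false)) (s := Iic q),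
      measureReal_nonneg (μ := scoreKernel D s (p, true)) (s := Iic q)]

theorem abs_bigPi_le (hβ : β ∈ Ioo (0 : ℝ) 1) (q p : ℝ) : |bigPi D β q p| ≤ (1 - β)⁻¹ := by
  unfold bigPi
  rw [← tsum_geometric_of_lt_one hβ.1.le hβ.2, ← Real.norm_eq_abs]
  refine tsum_of_norm_bounded (summable_geometric_of_lt_one hβ.1.le hβ.2).hasSum fun s => ?_
  rw [norm_mul, Real.norm_eq_abs, abs_of_nonneg (pow_nonneg hβ.1.le _)]
  exact mul_le_of_le_one_right (pow_nonneg hβ.1.le _) (abs_cdf_diff_le_one _ _ _)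

/-- Integration by parts turns the discounted difference of a primitive into an integral operator
with kernel `Π`. -/
theorem scoreDiff_primitive (hβ : β ∈ Ioo (0 : ℝ) 1) {h : ℝ → ℝ} (hh : IntegrableOn h (Icc pl pu))
    {q : ℝ} (hq : ∀ s y, ∀ᵐ u ∂(scoreKernel D s (q, y)), u ∈ Icc pl pu) :
    scoreDiff D β (primitive pl pu h) q = -(β * ∫ τ in Icc pl pu, bigPi D β τ q * h τ) := by
  have hFm : ∀ s y, Measurable fun τ : ℝ => (scoreKernel D s (q, y)).real (Iic τ) := fun s y =>
    Monotone.measurable fun a b hab => measureReal_mono (Iic_subset_Iic.2 hab)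
  have hFi : ∀ s y, IntegrableOn (fun τ => h τ * (1 - (scoreKernel D s (q, y)).real (Iic τ)))
      (Icc pl pu) := by
    intro s y
    refine hh.mul_bdd (c := 1) (measurable_const.sub (hFm s y)).aestronglyMeasurable
      (Filter.Eventually.of_forall fun τ => ?_)
    rw [Real.norm_eq_abs, abs_le]
    constructor
    · linarith [measureReal_le_one (μ := scoreKernel D s (q, y)) (s := Iic τ)]
    · linarith [measureReal_nonneg (μ := scoreKernel D s (q, y)) (s := Iic τ)]
  let F : ℕ → ℝ → ℝ := fun s τ => β ^ s * ((scoreKernel D (s + 1) (q, true)).real (Iic τ) -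
    (scoreKernel D (s + 1) (q, false)).real (Iic τ)) * h τ
  have hFb : ∀ s τ, ‖F s τ‖ ≤ β ^ s * |h τ| := by
    intro s τ
    simp only [F]
    rw [norm_mul, norm_mul, Real.norm_eq_abs, abs_of_nonneg (pow_nonneg hβ.1.le _),
      Real.norm_eq_abs, Real.norm_eq_abs]
    refine mul_le_mul_of_nonneg_right ?_ (abs_nonneg _)
    exact mul_le_of_le_one_right (pow_nonneg hβ.1.le _) (abs_cdf_diff_le_one _ _ _)
  have hFmeas : ∀ s, AEStronglyMeasurable (F s) (volume.restrict (Icc pl pu)) := fun s =>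
    (((hFm _ _).sub (hFm _ _)).const_mul _).aestronglyMeasurable.mul hh.aestronglyMeasurable
  have hFint : ∀ s, Integrable (F s) (volume.restrict (Icc pl pu)) := fun s =>
    (hh.norm.const_mul (β ^ s)).mono' (hFmeas s) (Filter.Eventually.of_forall (hFb s))
  have hswap := integral_tsum_of_summable_integral_norm hFint ?_
  · have e : ∀ τ, bigPi D β τ q * h τ = ∑' s, F s τ := fun τ => tsum_mul_right.symm
    simp_rw [e]
    rw [← hswap, ← tsum_mul_left, ← tsum_neg]
    unfold scoreDiff
    refine tsum_congr fun s => ?_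
    rw [integral_primitive (hq _ _) hh, integral_primitive (hq _ _) hh,
      ← integral_sub (hFi _ _) (hFi _ _), ← integral_const_mul, ← integral_const_mul,
      ← integral_neg]
    congr 1 with τ
    simp only [F]
    ring
  · refine Summable.of_nonneg_of_le (fun s => integral_nonneg fun _ => norm_nonneg _) (fun s => ?_)
      ((summable_geometric_of_lt_one hβ.1.le hβ.2).mul_right (∫ τ in Icc pl pu, |h τ|))
    rw [← integral_const_mul]
    exact integral_mono (hFint s).norm (hh.norm.const_mul _) (hFb s)

theorem sq_integral_mul_le {α : Type*} [MeasurableSpace α] {ρ : Measure α} {f g : α → ℝ}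
    (hf : MemLp f 2 ρ) (hg : MemLp g 2 ρ) :
    (∫ a, f a * g a ∂ρ) ^ 2 ≤ (∫ a, f a ^ 2 ∂ρ) * ∫ a, g a ^ 2 ∂ρ := by
  have hfg : Integrable (fun a => f a * g a) ρ := hf.integrable_mul hg
  have hd := discrim_le_zero (a := ∫ a, f a ^ 2 ∂ρ) (b := 2 * ∫ a, f a * g a ∂ρ)
    (c := ∫ a, g a ^ 2 ∂ρ) fun t => by
      have h0 : 0 ≤ ∫ a, (t * f a + g a) ^ 2 ∂ρ := integral_nonneg fun _ => sq_nonneg _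
      have e : ∫ a, (t * f a + g a) ^ 2 ∂ρ =
          ∫ a, (t * t * f a ^ 2 + 2 * t * (f a * g a) + g a ^ 2) ∂ρ := by
        congr 1 with a
        ring
      rw [e, integral_add (f := fun a => t * t * f a ^ 2 + 2 * t * (f a * g a))
        ((hf.integrable_sq.const_mul _).add (hfg.const_mul _)) hg.integrable_sq,
        integral_add (hf.integrable_sq.const_mul _) (hfg.const_mul _), integral_const_mul,
        integral_const_mul] at h0
      linarith
  rw [discrim] at hd
  nlinarith

/-- The homogeneous integral equation has only the trivial integrable solution: a solution is
bounded because `Π` is, hence square integrable, and `β Π` is a contraction of `L²`. -/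
theorem ae_eq_zero_of_homogeneous (hβ : β ∈ Ioo (0 : ℝ) 1) (hcontr : Contraction β D pl pu)
    (hmem : ∀ᵐ q ∂(volume.restrict (Icc pl pu)), ∀ s y, ∀ᵐ u ∂(scoreKernel D s (q, y)),
      u ∈ Icc pl pu)
    {h : ℝ → ℝ} (hh : IntegrableOn h (Icc pl pu))
    (heq : ∀ᵐ q ∂(volume.restrict (Icc pl pu)), h q + scoreDiff D β (primitive pl pu h) q = 0) :
    h =ᵐ[volume.restrict (Icc pl pu)] 0 := by
  set ρ := (volume : Measure ℝ).restrict (Icc pl pu) with hρ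
  have hfin : IsFiniteMeasure ρ := by infer_instance
  have hPm : ∀ q, Measurable fun τ => bigPi D β τ q := measurable_bigPi_left
  have hP2 : ∀ q, MemLp (fun τ => bigPi D β τ q) 2 ρ := fun q =>
    MemLp.of_bound (hPm q).aestronglyMeasurable _
      (Filter.Eventually.of_forall fun τ => abs_bigPi_le hβ τ q)
  have hfix : ∀ᵐ q ∂ρ, h q = β * ∫ τ, bigPi D β τ q * h τ ∂ρ := by
    filter_upwards [heq, hmem] with q h1 h2
    rw [scoreDiff_primitive hβ hh h2] at h1
    linarith
  have hb : 0 < (1 - β)⁻¹ := inv_pos.2 (by linarith [hβ.2])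
  have hbdd : ∀ᵐ q ∂ρ, ‖h q‖ ≤ β * ∫ τ, (1 - β)⁻¹ * |h τ| ∂ρ := by
    filter_upwards [hfix] with q hq
    rw [hq, norm_mul, Real.norm_eq_abs, abs_of_nonneg hβ.1.le]
    refine mul_le_mul_of_nonneg_left ?_ hβ.1.le
    refine norm_integral_le_of_norm_le (hh.norm.const_mul _) (Filter.Eventually.of_forall fun τ => ?_)
    rw [norm_mul]
    exact mul_le_mul_of_nonneg_right (abs_bigPi_le hβ τ q) (norm_nonneg _)
  have hh2 : MemLp h 2 ρ := MemLp.of_bound hh.aestronglyMeasurable _ hbdd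
  set n := ∫ τ, h τ ^ 2 ∂ρ with hn
  have hn0 : 0 ≤ n := integral_nonneg fun _ => sq_nonneg _
  have hPi : Integrable (fun q => ∫ τ, bigPi D β τ q ^ 2 ∂ρ) ρ := by
    have hm : Measurable fun q => ∫ τ, bigPi D β τ q ^ 2 ∂ρ :=
      measurable_integral_sq (F := bigPi D β) measurable_bigPi ρ
    refine Integrable.of_bound hm.aestronglyMeasurable (((1 - β)⁻¹) ^ 2 * ρ.real univ)
      (Filter.Eventually.of_forall fun q => ?_)
    refine norm_integral_le_of_norm_le_const (Filter.Eventually.of_forall fun τ => ?_)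
    rw [norm_pow]
    exact pow_le_pow_left₀ (norm_nonneg _) (abs_bigPi_le hβ τ q) 2
  have hle : n ≤ β ^ 2 * (∫ q, (∫ τ, bigPi D β τ q ^ 2 ∂ρ) ∂ρ) * n := by
    rw [mul_assoc, ← integral_mul_const, ← integral_const_mul]
    refine integral_mono_ae hh2.integrable_sq ((hPi.mul_const _).const_mul _) ?_
    filter_upwards [hfix] with q hq
    rw [hq, mul_pow]
    exact mul_le_mul_of_nonneg_left (sq_integral_mul_le (hP2 q) hh2) (sq_nonneg _)
  have hc : β ^ 2 * (∫ q, (∫ τ, bigPi D β τ q ^ 2 ∂ρ) ∂ρ) < 1 := hcontr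
  have hzero : n = 0 := by
    by_contra hne
    have hpos : 0 < n := lt_of_le_of_ne hn0 (Ne.symm hne)
    exact absurd hle (not_le.2 (mul_lt_of_lt_one_left hpos hc))
  have h0 := (integral_eq_zero_iff_of_nonneg (fun τ => sq_nonneg (h τ)) hh2.integrable_sq).1 hzero
  filter_upwards [h0] with τ hτ
  simpa using hτ

end IntegralEquation

/-! ### From the quantile function to the index -/

section Index

variable {k k₀ k₁ : ℕ} {D : Measure (ℕ → Obs k)} [IsProbabilityMeasure D] {pl pu β : ℝ}

theorem ae_integrable_levelKernel {f : State k → ℝ} (hf : Integrable f (stateLaw D)) :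
    ∀ᵐ q ∂((stateLaw D).map (choiceProb D)), Integrable f (levelKernel D q) := by
  have hm := measurable_choiceProb (D := D)
  have h : Integrable (fun z : ℝ × State k => f z.2)
      (D.map fun ω => (choiceProb D (ω 0).1, (ω 0).1)) := by
    have e : D.map (fun ω => (choiceProb D (ω 0).1, (ω 0).1)) =
        (stateLaw D).map fun x => (choiceProb D x, x) := by
      rw [stateLaw, Measure.map_map (by fun_prop) (by fun_prop)]
      rfl
    have e2 : ((stateLaw D).map fun x => (choiceProb D x, x)).map Prod.snd = stateLaw D := by
      rw [Measure.map_map (by fun_prop) (by fun_prop)]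
      exact Measure.map_id
    rw [e]
    rw [← e2] at hf
    exact hf.comp_measurable measurable_snd
  rw [stateLaw_map_choiceProb]
  exact h.condDistrib_ae_map (Measurable.aemeasurable (by fun_prop))

theorem primitive_sub_sum {Q : ℝ → ℝ} (hQ : IntegrableOn Q (Icc pl pu)) {ι : Type*} [Fintype ι]
    {B : ι → ℝ → ℝ} (hB : ∀ i, IntegrableOn (B i) (Icc pl pu)) (c : ι → ℝ) (q : ℝ) :
    primitive pl pu (fun τ => Q τ - ∑ i, c i * B i τ) q =
      primitive pl pu Q q - ∑ i, c i * primitive pl pu (B i) q := by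
  have hQ' : IntervalIntegrable ((Icc pl pu).indicator Q) volume pl q :=
    (hQ.integrable_indicator measurableSet_Icc).intervalIntegrable
  have hB' : ∀ i, IntervalIntegrable ((Icc pl pu).indicator (B i)) volume pl q := fun i =>
    ((hB i).integrable_indicator measurableSet_Icc).intervalIntegrable
  have hS : IntervalIntegrable (fun τ => ∑ i, c i * (Icc pl pu).indicator (B i) τ) volume pl q := by
    have := IntervalIntegrable.sum Finset.univ fun i _ => (hB' i).const_mul (c i)
    rwa [Finset.sum_fn] at this
  unfold primitive
  simp_rw [← intervalIntegral.integral_const_mul]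
  rw [← intervalIntegral.integral_finsetSum fun i _ => (hB' i).const_mul _,
    ← intervalIntegral.integral_sub hQ' hS]
  congr 1 with τ
  by_cases hτ : τ ∈ Icc pl pu <;> simp [hτ]

theorem primitive_eq_zero_of_ae_eq_zero {h : ℝ → ℝ} (hh : h =ᵐ[volume.restrict (Icc pl pu)] 0)
    (q : ℝ) : primitive pl pu h q = 0 := by
  have h0 : (Icc pl pu).indicator h =ᵐ[volume] 0 := by
    filter_upwards [(ae_restrict_iff' measurableSet_Icc).1 hh] with τ hτ
    by_cases hmem : τ ∈ Icc pl pu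
    · rw [indicator_of_mem hmem, hτ hmem]
    · rw [indicator_of_notMem hmem]
      rfl
  rw [primitive, intervalIntegral.integral_congr_ae (h0.mono fun τ hτ _ => hτ)]
  simp

/-- If the quantile function `Q` of the shocks satisfies the optimality equation state by state,
then averaging over the states with a given choice probability shows that `Q` and `θ·B` solve the
same integral equation, so that `Q (p (X))` is the index `θ·m(X)`. -/
theorem ae_eq_index (W : Transforms k k₀ k₁) (hβ : β ∈ Ioo (0 : ℝ) 1)
    (hphi : ∀ j, Integrable (phi W β D j) (stateLaw D))
    (hp : ScoreInterval D pl pu) (hst : ∀ s, D.map (fun ω => (ω s).1) = stateLaw D)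
    (hcontr : Contraction β D pl pu) {B : Coord k₀ k₁ → ℝ → ℝ}
    (hB : IsBasisSolution W β D pl pu B) {Q : ℝ → ℝ} (hQ : IntegrableOn Q (Icc pl pu))
    (θ : EuclideanSpace ℝ (Coord k₀ k₁))
    (heq : ∀ᵐ x ∂(stateLaw D), Q (choiceProb D x) = ∑ j, θ j * phi W β D j x -
      stateDiff D β (fun o => primitive pl pu Q (choiceProb D o.1)) x) :
    ∀ᵐ x ∂(stateLaw D), Q (choiceProb D x) = ∑ j, θ j * mIndex W β D pl B j x := by
  have hm := measurable_choiceProb (D := D)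
  have hprim : ∀ {h : ℝ → ℝ}, IntegrableOn h (Icc pl pu) → Measurable (primitive pl pu h) :=
    fun hh => (continuous_primitive_Icc hh).measurable
  have hBi : ∀ j, IntegrableOn (B j) (Icc pl pu) := fun j => (hB j).1
  have hmem := hp.ae_scoreKernel_mem hst
  -- The equation for `Q` given `p(X)`.
  have hQeq : ∀ᵐ q ∂(volume.restrict (Icc pl pu)),
      Q q + scoreDiff D β (primitive pl pu Q) q = ∑ j, θ j * zFun W β D j q := by
    refine hp.ae_score_iff.1 ?_
    filter_upwards [hp.ae_scoreDiff_eq_integral hβ (hprim hQ) (abs_primitive_le hQ),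
      ae_levelKernel heq, ae_all_iff.2 fun j => ae_integrable_levelKernel (hphi j)] with q h1 h2 h3
    have h4 : ∫ x, stateDiff D β (fun o => primitive pl pu Q (choiceProb D o.1)) x
        ∂(levelKernel D q) = ∫ x, (∑ j, θ j * phi W β D j x - Q q) ∂(levelKernel D q) := by
      refine integral_congr_ae ?_
      filter_upwards [h2] with x hx
      rw [← hx.2]
      linarith [hx.1]
    rw [h1, h4, integral_sub (integrable_finsetSum _ fun j _ => (h3 j).const_mul _)
      (integrable_const _), integral_finsetSum _ fun j _ => (h3 j).const_mul _]
    simp_rw [integral_const_mul]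
    rw [integral_const, probReal_univ, one_smul, add_sub_cancel]
    rfl
  have hBeq : ∀ᵐ q ∂(volume.restrict (Icc pl pu)), ∀ j,
      B j q + scoreDiff D β (primitive pl pu (B j)) q = zFun W β D j q := by
    refine ae_all_iff.2 fun j => ?_
    filter_upwards [(hB j).2, hmem] with q h1 h2
    rw [← h1]
    congr 1
    exact discountedDiff_congr fun s y => (h2 (s + 1) y).mono fun u hu => primitive_eq hu
  have hsub := primitive_sub_sum hQ hBi θ
  have hzero : (fun τ => Q τ - ∑ j, θ j * B j τ) =ᵐ[volume.restrict (Icc pl pu)] 0 := by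
    refine ae_eq_zero_of_homogeneous hβ hcontr hmem
      (hQ.sub (integrable_finsetSum _ fun j _ => (hBi j).const_mul _)) ?_
    filter_upwards [hQeq, hBeq] with q h1 h2
    have h3 : scoreDiff D β (primitive pl pu fun τ => Q τ - ∑ j, θ j * B j τ) q =
        scoreDiff D β (primitive pl pu Q) q -
          ∑ j, θ j * scoreDiff D β (primitive pl pu (B j)) q := by
      rw [funext hsub]
      simp_rw [scoreDiff_eq_discountedDiff]
      rw [← discountedDiff_sum hβ (fun j => hprim (hBi j)) (fun j => abs_primitive_le (hBi j)),
        discountedDiff_sub hβ (hprim hQ)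
          (Finset.measurable_sum _ fun j _ => (hprim (hBi j)).const_mul _) (abs_primitive_le hQ)
          (C' := ∑ j, |θ j| * ∫ τ in Icc pl pu, |B j τ|)]
      intro a
      refine (Finset.abs_sum_le_sum_abs _ _).trans (Finset.sum_le_sum fun j _ => ?_)
      rw [abs_mul]
      exact mul_le_mul_of_nonneg_left (abs_primitive_le (hBi j) a) (abs_nonneg _)
    have h4 : ∑ j, θ j * B j q + ∑ j, θ j * scoreDiff D β (primitive pl pu (B j)) q =
        ∑ j, θ j * zFun W β D j q := by
      rw [← Finset.sum_add_distrib]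
      exact Finset.sum_congr rfl fun j _ => by rw [← h2 j]; ring
    rw [h3]
    linarith
  have hprimQ : primitive pl pu Q = fun q => ∑ j, θ j * primitive pl pu (B j) q := by
    ext q
    have := hsub q
    rw [primitive_eq_zero_of_ae_eq_zero hzero q] at this
    linarith
  filter_upwards [heq, hp.ae_obsKernel hst hp.ae_mem] with x h1 h2
  have h3 : stateDiff D β (fun o => primitive pl pu Q (choiceProb D o.1)) x =
      ∑ j, θ j * stateDiff D β (fun o => ∫ τ in pl..(choiceProb D o.1), B j τ) x := by
    rw [hprimQ]
    simp_rw [stateDiff_eq_discountedDiff]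
    rw [discountedDiff_sum hβ (f := fun j (o : Obs k) => primitive pl pu (B j) (choiceProb D o.1))
      (fun j => (hprim (hBi j)).comp (hm.comp measurable_fst))
      (fun j o => abs_primitive_le (hBi j) _)]
    refine Finset.sum_congr rfl fun j _ => ?_
    congr 1
    exact discountedDiff_congr fun s y => (h2 (s + 1) y).mono fun o ho => primitive_eq ho.2
  rw [h1, h3, ← Finset.sum_sub_distrib]
  exact Finset.sum_congr rfl fun j _ => by rw [mIndex]; ring

end Index

/-! ### Laws of the controlled process -/

section ControlledLaw

open scoped ENNReal

variable {k k₀ k₁ : ℕ}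

instance (M : Model k k₀ k₁) : IsProbabilityMeasure M.law := M.isProbabilityMeasure_law

instance (M : Model k k₀ k₁) : IsMarkovKernel M.trans := M.isMarkovKernel_trans

instance (M : Model k k₀ k₁) : IsProbabilityMeasure M.shockLaw :=
  Measure.isProbabilityMeasure_map (Measurable.aemeasurable (by fun_prop))

instance (M : Model k k₀ k₁) : IsProbabilityMeasure M.etaLaw :=
  Measure.isProbabilityMeasure_map (Measurable.aemeasurable (by fun_prop))

/-- The law of `(x, δ (x, ε))` when the shocks `ε` have law `F`. -/
def choiceKernel (F : Measure Shock) (δ : State k × Shock → Bool) : Kernel (State k) (Obs k) :=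
  (Kernel.id ×ₖ Kernel.const (State k) F).map fun z => (z.1, δ z)

/-- The law of `X_{s+1}` given `(X_0, Y_0)` when the decision rule `δ` is used from date `1` on,
states follow `κ`, and shocks are drawn independently from `F`. -/
def stateKernel (κ : Kernel (Obs k) (State k)) (F : Measure Shock) (δ : State k × Shock → Bool) :
    ℕ → Kernel (Obs k) (State k)
  | 0 => κ
  | s + 1 => κ ∘ₖ (choiceKernel F δ ∘ₖ stateKernel κ F δ s)

variable {κ : Kernel (Obs k) (State k)} {F : Measure Shock}
  [IsProbabilityMeasure F] {δ : State k × Shock → Bool}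

theorem isMarkovKernel_choiceKernel (hδ : Measurable δ) : IsMarkovKernel (choiceKernel F δ) :=
  Kernel.IsMarkovKernel.map _ (by fun_prop)

theorem isMarkovKernel_stateKernel [IsMarkovKernel κ] (hδ : Measurable δ) (s : ℕ) :
    IsMarkovKernel (stateKernel κ F δ s) := by
  have := isMarkovKernel_choiceKernel (F := F) hδ
  induction s with
  | zero => rw [stateKernel]; infer_instance
  | succ s ih => rw [stateKernel]; infer_instance

theorem lintegral_choiceKernel (hδ : Measurable δ) (x : State k) {f : Obs k → ℝ≥0∞}
    (hf : Measurable f) : ∫⁻ o, f o ∂(choiceKernel F δ x) = ∫⁻ e, f (x, δ (x, e)) ∂F := by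
  rw [choiceKernel, Kernel.lintegral_map _ (by fun_prop) _ hf, Kernel.lintegral_id_prod]
  · simp
  · fun_prop

theorem lintegral_stateKernel_succ (hδ : Measurable δ) (s : ℕ) (o : Obs k) {f : State k → ℝ≥0∞}
    (hf : Measurable f) : ∫⁻ x, f x ∂(stateKernel κ F δ (s + 1) o) =
      ∫⁻ x, ∫⁻ e, ∫⁻ x', f x' ∂(κ (x, δ (x, e))) ∂F ∂(stateKernel κ F δ s o) := by
  have := isMarkovKernel_choiceKernel (F := F) hδ
  rw [stateKernel, Kernel.lintegral_comp _ _ _ hf, Kernel.lintegral_comp _ _ _ hf.lintegral_kernel]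
  exact lintegral_congr fun x => lintegral_choiceKernel hδ x hf.lintegral_kernel

variable {M : Model k k₀ k₁}

theorem lintegral_next {W : Transforms k k₀ k₁} {β : ℝ} (hE : IsEquilibrium W β M)
    (hT : ∀ x e y, M.trans (x, e, y) = (κ (x, y)).prod M.shockLaw) (t : ℕ)
    {f : Obs k × State k × Shock → ℝ≥0∞} (hf : Measurable f) :
    ∫⁻ ω, f (((ω 0).1, (ω 0).2.2), (ω (t + 1)).1, (ω (t + 1)).2.1) ∂M.law =
      ∫⁻ ω, ∫⁻ z, f (((ω 0).1, (ω 0).2.2), z) ∂((κ ((ω t).1, (ω t).2.2)).prod M.shockLaw)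
        ∂M.law := by
  let g : (Fin (t + 1) → Period k) × State k × Shock → ℝ≥0∞ := fun h =>
    f (((h.1 0).1, (h.1 0).2.2), h.2)
  have hg : Measurable g := hf.comp (by fun_prop)
  have hm := congrArg (fun m => ∫⁻ h, g h ∂m) (hE.markov t)
  rw [lintegral_map hg (by fun_prop), Measure.lintegral_compProd hg,
    lintegral_map hg.lintegral_kernel_prod_right' (by fun_prop)] at hm
  refine hm.trans (lintegral_congr fun ω => ?_)
  rw [Kernel.comap_apply]
  have : M.trans (ω (Fin.last t : Fin (t + 1))) =
      (κ ((ω t).1, (ω t).2.2)).prod M.shockLaw := by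
    rw [← hT (ω t).1 (ω t).2.1 (ω t).2.2]
    simp
  rw [this]
  simp [g]

theorem stateLaw_observed : stateLaw M.observed = M.law.map fun ω => (ω 0).1 := by
  rw [stateLaw, Model.observed, Measure.map_map (by fun_prop) (by fun_prop)]
  rfl

theorem map_period_eq {W : Transforms k k₀ k₁} {β : ℝ} (hE : IsEquilibrium W β M) (s : ℕ) :
    M.law.map (fun ω => ω s) = M.law.map fun ω => ω 0 := by
  induction s with
  | zero => rfl
  | succ s ih =>
    rw [← ih]
    conv_rhs => rw [← hE.stationary]
    rw [Measure.map_map (by fun_prop) (by fun_prop)]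
    rfl

theorem map_state_observed {W : Transforms k k₀ k₁} {β : ℝ} (hE : IsEquilibrium W β M) (s : ℕ) :
    M.observed.map (fun ω => (ω s).1) = stateLaw M.observed := by
  have h := congrArg (fun m => m.map fun w : Period k => w.1) (map_period_eq hE s)
  rw [Measure.map_map (by fun_prop) (by fun_prop), Measure.map_map (by fun_prop) (by fun_prop)] at h
  rw [stateLaw_observed, Model.observed, Measure.map_map (by fun_prop) (by fun_prop)]
  exact h

/-- In a stationary process, the shocks are independent of the current state. -/
theorem map_state_shock {W : Transforms k k₀ k₁} {β : ℝ} (hE : IsEquilibrium W β M)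
    (hT : ∀ x e y, M.trans (x, e, y) = (κ (x, y)).prod M.shockLaw) :
    M.law.map (fun ω => ((ω 0).1, (ω 0).2.1)) = (stateLaw M.observed).prod M.shockLaw := by
  have key : ∀ f : State k × Shock → ℝ≥0∞, Measurable f →
      ∫⁻ ω, f ((ω 0).1, (ω 0).2.1) ∂M.law =
        ∫⁻ ω, ∫⁻ x, ∫⁻ e, f (x, e) ∂M.shockLaw ∂(κ ((ω 0).1, (ω 0).2.2)) ∂M.law := by
    intro f hf
    have h1 := congrArg (fun m => ∫⁻ w : Period k, f (w.1, w.2.1) ∂m) (map_period_eq hE 1)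
    rw [lintegral_map (by fun_prop) (by fun_prop), lintegral_map (by fun_prop) (by fun_prop)] at h1
    rw [← h1, lintegral_next hE hT 0 (f := fun w => f w.2) (by fun_prop)]
    refine lintegral_congr fun ω => ?_
    rw [lintegral_prod _ hf.aemeasurable]
  refine Measure.ext_of_lintegral _ fun f hf => ?_
  have hg : Measurable fun x => ∫⁻ e, f (x, e) ∂M.shockLaw := hf.lintegral_prod_right'
  rw [lintegral_map hf (by fun_prop), lintegral_prod _ hf.aemeasurable, stateLaw_observed,
    lintegral_map hg (by fun_prop), key f hf,
    key (fun z => ∫⁻ e, f (z.1, e) ∂M.shockLaw) (hg.comp measurable_fst)]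
  simp

variable [IsMarkovKernel κ]

/-- One transition applied to a state and independent shocks again gives a state and independent
shocks. -/
theorem lintegral_stateKernel_succ_prod (hδ : Measurable δ) (s : ℕ) (o : Obs k)
    {f : State k × Shock → ℝ≥0∞} (hf : Measurable f) :
    ∫⁻ z, ∫⁻ z', f z' ∂((κ (z.1, δ z)).prod F) ∂((stateKernel κ F δ s o).prod F) =
      ∫⁻ z', f z' ∂((stateKernel κ F δ (s + 1) o).prod F) := by
  have := isMarkovKernel_stateKernel (κ := κ) (F := F) hδ
  have h1 : Measurable fun x => ∫⁻ e, f (x, e) ∂F := hf.lintegral_prod_right'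
  have h2 : Measurable fun z : State k × Shock => ∫⁻ x', ∫⁻ e, f (x', e) ∂F ∂(κ (z.1, δ z)) :=
    h1.lintegral_kernel.comp (by fun_prop : Measurable fun z : State k × Shock => (z.1, δ z))
  simp_rw [lintegral_prod _ hf.aemeasurable]
  rw [lintegral_prod _ h2.aemeasurable, lintegral_stateKernel_succ hδ s o h1]

theorem stateAfter_succ_eq {T : Kernel (Period k) (State k × Shock)}
    (hT : ∀ x e y, T (x, e, y) = (κ (x, y)).prod F) (hδ : Measurable δ) {σ : Plan k}
    (hσ : ∀ s, σ.act (s + 1) = δ) (z : State k × Shock) (s : ℕ) :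
    stateAfter T σ (s + 1) z = (stateKernel κ F δ s (z.1, σ.act 0 z)).prod F := by
  induction s with
  | zero => simp [stateAfter, stateKernel, Kernel.comap_apply, hT]
  | succ s ih =>
    refine Measure.ext_of_lintegral _ fun f hf => ?_
    rw [stateAfter, Kernel.lintegral_comp _ _ _ hf, ih, ← lintegral_stateKernel_succ_prod hδ s _ hf]
    refine lintegral_congr fun z' => ?_
    rw [Kernel.comap_apply, hT, hσ]

/-- Given `(X_0, Y_0)`, the state `X_{s+1}` is distributed according to `stateKernel`, and the
shocks at date `s + 1` are independent of it. -/
theorem lintegral_obs_state {W : Transforms k k₀ k₁} {β : ℝ} (hE : IsEquilibrium W β M)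
    (hT : ∀ x e y, M.trans (x, e, y) = (κ (x, y)).prod M.shockLaw) (hδ : Measurable δ)
    (hY : ∀ t, ∀ᵐ ω ∂M.law, (ω t).2.2 = δ ((ω t).1, (ω t).2.1)) (s : ℕ)
    {f : Obs k × State k × Shock → ℝ≥0∞} (hf : Measurable f) :
    ∫⁻ ω, f (((ω 0).1, (ω 0).2.2), (ω (s + 1)).1, (ω (s + 1)).2.1) ∂M.law =
      ∫⁻ ω, ∫⁻ z, f (((ω 0).1, (ω 0).2.2), z)
        ∂((stateKernel κ M.shockLaw δ s ((ω 0).1, (ω 0).2.2)).prod M.shockLaw) ∂M.law := by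
  induction s generalizing f with
  | zero => exact lintegral_next hE hT 0 hf
  | succ s ih =>
    rw [lintegral_next hE hT (s + 1) hf]
    let G : Obs k × State k × Shock → ℝ≥0∞ := fun w =>
      ∫⁻ z, f (w.1, z) ∂((κ (w.2.1, δ w.2)).prod M.shockLaw)
    have hG : Measurable G := by
      have hc : Measurable fun w : Obs k × State k × Shock => (w.2.1, δ w.2) := by fun_prop
      have := Measurable.lintegral_kernel_prod_right'
        (κ := (κ ×ₖ Kernel.const (Obs k) M.shockLaw).comap _ hc)
        (f := fun v : (Obs k × State k × Shock) × State k × Shock => f (v.1.1, v.2)) (by fun_prop)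
      simpa [Kernel.comap_apply, Kernel.prod_apply] using this
    have h1 : ∫⁻ ω, ∫⁻ z, f (((ω 0).1, (ω 0).2.2), z)
          ∂((κ ((ω (s + 1)).1, (ω (s + 1)).2.2)).prod M.shockLaw) ∂M.law =
        ∫⁻ ω, G (((ω 0).1, (ω 0).2.2), (ω (s + 1)).1, (ω (s + 1)).2.1) ∂M.law := by
      refine lintegral_congr_ae ((hY (s + 1)).mono fun ω hω => ?_)
      simp only [G]
      rw [hω]
    rw [h1, ih hG]
    refine lintegral_congr fun ω => ?_
    exact lintegral_stateKernel_succ_prod hδ s _ (hf.comp measurable_prodMk_left)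

end ControlledLaw

/-! ### Laws of the observed process -/

section Observed

open scoped ENNReal

variable {k k₀ k₁ : ℕ} {κ : Kernel (Obs k) (State k)} {δ : State k × Shock → Bool} {M : Model k k₀ k₁}
  {W : Transforms k k₀ k₁} {β : ℝ}

theorem map_stateKernel_prod [IsMarkovKernel κ] {F : Measure Shock} [IsProbabilityMeasure F]
    (hδ : Measurable δ)
    (s : ℕ) (o : Obs k) :
    ((stateKernel κ F δ s o).prod F).map (fun z => (z.1, δ z)) =
      (choiceKernel F δ ∘ₖ stateKernel κ F δ s) o := by
  have := isMarkovKernel_stateKernel (κ := κ) (F := F) hδ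
  refine Measure.ext_of_lintegral _ fun f hf => ?_
  have hm : Measurable fun z : State k × Shock => (z.1, δ z) := by fun_prop
  have hfm : Measurable fun z : State k × Shock => f (z.1, δ z) := hf.comp hm
  rw [lintegral_map hf hm, lintegral_prod _ hfm.aemeasurable,
    Kernel.lintegral_comp _ _ _ hf]
  exact lintegral_congr fun x => (lintegral_choiceKernel hδ x hf).symm

/-- The conditional choice probability is the probability of the shocks for which the decision
rule chooses action `1`. -/
theorem ae_choiceProb_eq (hE : IsEquilibrium W β M)
    (hT : ∀ x e y, M.trans (x, e, y) = (κ (x, y)).prod M.shockLaw) (hδ : Measurable δ)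
    (hY : ∀ t, ∀ᵐ ω ∂M.law, (ω t).2.2 = δ ((ω t).1, (ω t).2.1)) :
    ∀ᵐ x ∂(stateLaw M.observed),
      choiceProb M.observed x = M.shockLaw.real {e | δ (x, e) = true} := by
  have := isMarkovKernel_choiceKernel (F := M.shockLaw) hδ
  have hker : condDistrib (fun ω : ℕ → Obs k => (ω 0).2) (fun ω => (ω 0).1) M.observed
      =ᵐ[stateLaw M.observed] (choiceKernel M.shockLaw δ).map Prod.snd := by
    have : IsMarkovKernel ((choiceKernel M.shockLaw δ).map Prod.snd) :=
      Kernel.IsMarkovKernel.map _ measurable_snd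
    refine condDistrib_ae_eq_of_measure_eq_compProd_of_measurable (by fun_prop) (by fun_prop) ?_
    refine Measure.ext_of_lintegral _ fun f hf => ?_
    have h1 : Measurable fun z : State k × Shock => f (z.1, δ z) := by fun_prop
    have hst : M.observed.map (fun ω => (ω 0).1) = stateLaw M.observed := rfl
    rw [Model.observed, Measure.map_map (by fun_prop) (by fun_prop), lintegral_map hf (by fun_prop),
      ← Model.observed, Measure.lintegral_compProd hf, hst]
    have h2 : ∫⁻ ω, f ((ω 0).1, (ω 0).2.2) ∂M.law =
        ∫⁻ ω, f ((ω 0).1, δ ((ω 0).1, (ω 0).2.1)) ∂M.law :=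
      lintegral_congr_ae ((hY 0).mono fun ω hω => by simp only [hω])
    refine h2.trans ?_
    rw [← lintegral_map (f := fun z : State k × Shock => f (z.1, δ z))
      (g := fun ω : ℕ → Period k => ((ω 0).1, (ω 0).2.1)) h1 (by fun_prop), map_state_shock hE hT,
      lintegral_prod _ h1.aemeasurable]
    refine lintegral_congr fun x => ?_
    rw [Kernel.lintegral_map _ measurable_snd _ (by fun_prop), lintegral_choiceKernel hδ x
      (f := fun o => f (x, o.2)) (by fun_prop)]
  filter_upwards [hker] with x hx
  rw [choiceProb, hx, measureReal_def, measureReal_def,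
    Kernel.map_apply' _ measurable_snd _ (measurableSet_singleton _), ← lintegral_indicator_one
      (measurable_snd (measurableSet_singleton _)), lintegral_choiceKernel hδ x
      (measurable_one.indicator (measurable_snd (measurableSet_singleton _))),
    ← lintegral_indicator_one]
  · rfl
  · exact (hδ.comp measurable_prodMk_left) (measurableSet_singleton true)

theorem ae_obsKernel_eq [IsMarkovKernel κ] (hE : IsEquilibrium W β M)
    (hT : ∀ x e y, M.trans (x, e, y) = (κ (x, y)).prod M.shockLaw) (hδ : Measurable δ)
    (hY : ∀ t, ∀ᵐ ω ∂M.law, (ω t).2.2 = δ ((ω t).1, (ω t).2.1)) :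
    ∀ᵐ o ∂(M.observed.map fun ω => ω 0), ∀ s, obsKernel M.observed (s + 1) o =
      ((stateKernel κ M.shockLaw δ s o).prod M.shockLaw).map fun z => (z.1, δ z) := by
  have := isMarkovKernel_choiceKernel (F := M.shockLaw) hδ
  have := isMarkovKernel_stateKernel (κ := κ) (F := M.shockLaw) hδ
  refine ae_all_iff.2 fun s => ?_
  simp_rw [map_stateKernel_prod hδ]
  refine condDistrib_ae_eq_of_measure_eq_compProd_of_measurable (by fun_prop) (by fun_prop) ?_
  refine Measure.ext_of_lintegral _ fun f hf => ?_
  have hK : Measurable fun o =>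
      ∫⁻ o', f (o, o') ∂((choiceKernel M.shockLaw δ ∘ₖ stateKernel κ M.shockLaw δ s) o) :=
    hf.lintegral_kernel_prod_right'
  have hz : Measurable fun z : State k × Shock => (z.1, δ z) := by fun_prop
  have h1 : Measurable fun w : Obs k × State k × Shock => f (w.1, w.2.1, δ w.2) := by fun_prop
  rw [Measure.lintegral_compProd hf, Model.observed, Measure.map_map (by fun_prop) (by fun_prop),
    Measure.map_map (by fun_prop) (by fun_prop), lintegral_map hf (by fun_prop),
    lintegral_map hK (by fun_prop)]
  have h2 : ∫⁻ ω, f (((ω 0).1, (ω 0).2.2), (ω (s + 1)).1, (ω (s + 1)).2.2) ∂M.law =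
      ∫⁻ ω, f (((ω 0).1, (ω 0).2.2), (ω (s + 1)).1, δ ((ω (s + 1)).1, (ω (s + 1)).2.1)) ∂M.law :=
    lintegral_congr_ae ((hY (s + 1)).mono fun ω hω => by simp only [hω])
  refine h2.trans ((lintegral_obs_state hE hT hδ hY s h1).trans (lintegral_congr fun ω => ?_))
  simp only [Function.comp_apply]
  have h3 : Measurable fun o' => f (((ω 0).1, (ω 0).2.2), o') := hf.comp measurable_prodMk_left
  rw [← map_stateKernel_prod hδ, lintegral_map h3 hz]

variable {D : Measure (ℕ → Obs k)} [IsProbabilityMeasure D] {pl pu : ℝ}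

theorem ae_lintegral_condDistrib_state (s : ℕ) {g : State k → ℝ≥0∞} (hg : Measurable g) :
    ∀ᵐ x ∂(stateLaw D), ∫⁻ x', g x'
        ∂(condDistrib (fun ω : ℕ → Obs k => (ω s).1) (fun ω => (ω 0).1) D x) =
      ∑ y, actionWeight (choiceProb D x) y * ∫⁻ o, g o.1 ∂(obsKernel D s (x, y)) := by
  set cY := condDistrib (fun ω : ℕ → Obs k => (ω 0).2) (fun ω => (ω 0).1) D
  have hmk : IsMarkovKernel ((obsKernel D s).map Prod.fst) :=
    Kernel.IsMarkovKernel.map _ measurable_fst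
  let N : Kernel (State k) (State k) := ((obsKernel D s).map Prod.fst) ∘ₖ (Kernel.id ×ₖ cY)
  have hN : ∀ x, ∀ g : State k → ℝ≥0∞, Measurable g → ∫⁻ x', g x' ∂(N x) =
      ∑ y, actionWeight (choiceProb D x) y * ∫⁻ o, g o.1 ∂(obsKernel D s (x, y)) := by
    intro x g hg
    rw [Kernel.lintegral_comp _ _ _ hg, Kernel.lintegral_id_prod hg.lintegral_kernel,
      lintegral_fintype]
    refine Finset.sum_congr rfl fun y _ => ?_
    rw [condDistrib_action_singleton, mul_comm, Kernel.lintegral_map _ measurable_fst _ hg]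
  have hker : condDistrib (fun ω : ℕ → Obs k => (ω s).1) (fun ω => (ω 0).1) D
      =ᵐ[stateLaw D] N := by
    refine condDistrib_ae_eq_of_measure_eq_compProd_of_measurable (by fun_prop) (by fun_prop) ?_
    refine Measure.ext_of_lintegral _ fun f hf => ?_
    have hf' : Measurable fun z : Obs k × Obs k => f (z.1.1, z.2.1) := by fun_prop
    have hst : D.map (fun ω => (ω 0).1) = stateLaw D := rfl
    rw [lintegral_map hf (by fun_prop), ← lintegral_map (f := fun z : Obs k × Obs k =>
      f (z.1.1, z.2.1)) (g := fun ω : ℕ → Obs k => (ω 0, ω s)) hf' (by fun_prop),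
      map_obs_eq_compProd, Measure.lintegral_compProd hf', Measure.lintegral_compProd hf,
      lintegral_obs_zero hf'.lintegral_kernel_prod_right', hst]
    refine lintegral_congr fun x => ?_
    rw [hN x (fun x' => f (x, x')) (by fun_prop)]
  filter_upwards [hker] with x hx
  rw [hx, hN x g hg]

/-- As both actions have positive probability, discounted expectations that are finite given the
state are finite given the state and either action. -/
theorem ScoreInterval.ae_tsum_lt_top (hp : ScoreInterval D pl pu) {g : State k → ℝ≥0∞}
    (hg : Measurable g)
    (h : ∀ᵐ x ∂(stateLaw D), ∑' s : ℕ, ENNReal.ofReal (β ^ (s + 1)) * ∫⁻ x', g x'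
      ∂(condDistrib (fun ω : ℕ → Obs k => (ω (s + 1)).1) (fun ω => (ω 0).1) D x) < ⊤) :
    ∀ᵐ x ∂(stateLaw D), ∀ y, ∑' s : ℕ, ENNReal.ofReal (β ^ (s + 1)) *
      ∫⁻ o, g o.1 ∂(obsKernel D (s + 1) (x, y)) < ⊤ := by
  filter_upwards [h, hp.ae_mem,
    ae_all_iff.2 fun s : ℕ => ae_lintegral_condDistrib_state (D := D) (s + 1) hg] with x h1 h2 h3 y
  have hle : actionWeight (choiceProb D x) y * ∑' s : ℕ, ENNReal.ofReal (β ^ (s + 1)) *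
      ∫⁻ o, g o.1 ∂(obsKernel D (s + 1) (x, y)) ≤
      ∑' s : ℕ, ENNReal.ofReal (β ^ (s + 1)) * ∫⁻ x', g x'
      ∂(condDistrib (fun ω : ℕ → Obs k => (ω (s + 1)).1) (fun ω => (ω 0).1) D x) := by
    rw [← ENNReal.tsum_mul_left]
    refine ENNReal.tsum_le_tsum fun s => ?_
    rw [h3 s, mul_left_comm]
    gcongr
    exact Finset.single_le_sum (f := fun y => actionWeight (choiceProb D x) y *
      ∫⁻ o, g o.1 ∂(obsKernel D (s + 1) (x, y))) (fun _ _ => zero_le) (Finset.mem_univ y)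
  by_contra htop
  rw [not_lt, top_le_iff] at htop
  rw [htop, ENNReal.mul_top (actionWeight_pos h2.1 y).ne'] at hle
  exact absurd h1 (not_lt.2 hle)

theorem integrable_summable_of_tsum_lintegral {α : Type*} [MeasurableSpace α] {ρ : ℕ → Measure α}
    (hβ : β ∈ Ioo (0 : ℝ) 1) {f : α → ℝ} (hf : Measurable f)
    (h : ∑' s : ℕ, ENNReal.ofReal (β ^ (s + 1)) * ∫⁻ a, ‖f a‖ₑ ∂(ρ s) < ⊤) :
    (∀ s, Integrable f (ρ s)) ∧ Summable fun s : ℕ => β ^ (s + 1) * ∫ a, |f a| ∂(ρ s) := by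
  have hpos : ∀ s : ℕ, 0 < β ^ (s + 1) := fun s => pow_pos hβ.1 _
  have hi : ∀ s, Integrable f (ρ s) := by
    intro s
    refine ⟨hf.aestronglyMeasurable, ?_⟩
    have h1 := ENNReal.ne_top_of_tsum_ne_top h.ne s
    by_contra h2
    rw [HasFiniteIntegral, not_lt, top_le_iff] at h2
    rw [h2, ENNReal.mul_top (by simpa using hpos s)] at h1
    exact h1 rfl
  refine ⟨hi, (ENNReal.summable_toReal h.ne).congr fun s => ?_⟩
  rw [ENNReal.toReal_mul, ENNReal.toReal_ofReal (hpos s).le, ← integral_norm_eq_lintegral_enorm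
    hf.aestronglyMeasurable]
  rfl

end Observed

/-! ### One-shot deviations -/

section Deviation

variable {k k₀ k₁ : ℕ} {κ : Kernel (Obs k) (State k)} {F : Measure Shock}
  {δ : State k × Shock → Bool} {W : Transforms k k₀ k₁} {β : ℝ}
  {θ : EuclideanSpace ℝ (Coord k₀ k₁)} {T : Kernel (Period k) (State k × Shock)}

/-- Expected utility at date `s + 1`, given `(X_0, Y_0) = o`, when `δ` is used from date `1` on. -/
def futureUtility (W : Transforms k k₀ k₁) (θ : EuclideanSpace ℝ (Coord k₀ k₁))
    (κ : Kernel (Obs k) (State k)) (F : Measure Shock) (δ : State k × Shock → Bool) (s : ℕ)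
    (o : Obs k) : ℝ :=
  ∫ z, utility W θ (δ z) z ∂((stateKernel κ F δ s o).prod F)

/-- After `(X_0, Y_0) = o`, expected discounted utility under `δ` converges absolutely. -/
structure FutureDefined (W : Transforms k k₀ k₁) (β : ℝ) (θ : EuclideanSpace ℝ (Coord k₀ k₁))
    (κ : Kernel (Obs k) (State k)) (F : Measure Shock) (δ : State k × Shock → Bool)
    (o : Obs k) : Prop where
  integrable : ∀ s, Integrable (fun z => utility W θ (δ z) z) ((stateKernel κ F δ s o).prod F)
  summable : Summable fun s : ℕ =>
    β ^ (s + 1) * ∫ z, |utility W θ (δ z) z| ∂((stateKernel κ F δ s o).prod F)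

theorem FutureDefined.summable_futureUtility {o : Obs k} (h : FutureDefined W β θ κ F δ o)
    (hβ : 0 < β) : Summable fun s : ℕ => β ^ (s + 1) * futureUtility W θ κ F δ s o := by
  refine Summable.of_norm_bounded h.summable fun s => ?_
  rw [norm_mul, Real.norm_of_nonneg (pow_pos hβ _).le]
  exact mul_le_mul_of_nonneg_left (norm_integral_le_integral_norm _) (pow_pos hβ _).le

variable [IsProbabilityMeasure F] [IsMarkovKernel κ]

theorem payoffDefined_of_futureDefined
    (hT : ∀ x e y, T (x, e, y) = (κ (x, y)).prod F) (hδ : Measurable δ) {σ : Plan k}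
    (hσ : ∀ s, σ.act (s + 1) = δ) {z : State k × Shock}
    (h : FutureDefined W β θ κ F δ (z.1, σ.act 0 z)) : PayoffDefined W β θ T σ z := by
  refine ⟨fun s => ?_, ?_⟩
  · cases s with
    | zero =>
      rw [stateAfter, Kernel.id_apply]
      exact integrable_dirac enorm_lt_top
    | succ s =>
      rw [stateAfter_succ_eq hT hδ hσ, hσ]
      exact h.integrable s
  · rw [← summable_nat_add_iff 1]
    refine h.summable.congr fun s => ?_
    rw [stateAfter_succ_eq hT hδ hσ, hσ]

theorem payoff_eq_utility_add
    (hT : ∀ x e y, T (x, e, y) = (κ (x, y)).prod F) (hδ : Measurable δ) (hβ : 0 < β) {σ : Plan k}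
    (hσ : ∀ s, σ.act (s + 1) = δ) {z : State k × Shock}
    (h : FutureDefined W β θ κ F δ (z.1, σ.act 0 z)) :
    payoff W β θ T σ z = utility W θ (σ.act 0 z) z +
      ∑' s : ℕ, β ^ (s + 1) * futureUtility W θ κ F δ s (z.1, σ.act 0 z) := by
  have hs : ∀ s : ℕ, β ^ (s + 1) * ∫ z', utility W θ (σ.act (s + 1) z') z'
      ∂(stateAfter T σ (s + 1) z) =
        β ^ (s + 1) * futureUtility W θ κ F δ s (z.1, σ.act 0 z) := by
    intro s
    rw [stateAfter_succ_eq hT hδ hσ, hσ, futureUtility]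
  unfold payoff
  rw [((summable_nat_add_iff 1).1
    ((h.summable_futureUtility hβ).congr fun s => (hs s).symm)).tsum_eq_zero_add]
  simp_rw [hs]
  rw [stateAfter, Kernel.id_apply, integral_dirac, pow_zero, one_mul]

/-- Where `δ` is optimal, it is at least as good as choosing the other action once. -/
theorem deviation_le (hT : ∀ x e y, T (x, e, y) = (κ (x, y)).prod F) (hδ : Measurable δ)
    (hβ : 0 < β) {z : State k × Shock} (h : ∀ y, FutureDefined W β θ κ F δ (z.1, y))
    (hopt : IsOptimalAt W β θ T (Plan.stationary δ hδ) z) :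
    utility W θ (!δ z) z + ∑' s : ℕ, β ^ (s + 1) * futureUtility W θ κ F δ s (z.1, !δ z) ≤
      utility W θ (δ z) z + ∑' s : ℕ, β ^ (s + 1) * futureUtility W θ κ F δ s (z.1, δ z) := by
  let τ : Plan k :=
    { act := fun t => match t with
        | 0 => fun z => !δ z
        | _ + 1 => δ
      measurable_act := fun t => match t with
        | 0 => (measurable_of_finite (fun b : Bool => !b)).comp hδ
        | _ + 1 => hδ }
  have hτ : ∀ s, τ.act (s + 1) = δ := fun s => rfl
  have h1 := hopt.2 τ (payoffDefined_of_futureDefined hT hδ hτ (h _))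
  rwa [payoff_eq_utility_add hT hδ hβ hτ (h _),
    payoff_eq_utility_add hT hδ hβ (σ := Plan.stationary δ hδ) (fun _ => rfl) (h _)] at h1

/-! ### The components of utility -/

/-- The part of utility that multiplies the coordinate `j` of `θ`. -/
def feature (W : Transforms k k₀ k₁) : Coord k₀ k₁ → Obs k → ℝ
  | Sum.inl i, o => if o.2 then 0 else W.W₀ o.1 i
  | Sum.inr i, o => if o.2 then W.W₁ o.1 i else 0

/-- The shock to the utility of the chosen action. -/
def chosenShock (δ : State k × Shock → Bool) (z : State k × Shock) : ℝ :=
  if δ z then z.2.2 else z.2.1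

theorem measurable_feature (j : Coord k₀ k₁) : Measurable (feature W j) := by
  have hb : MeasurableSet {o : Obs k | o.2 = true} :=
    measurable_snd (measurableSet_singleton true)
  have h0 := W.measurable_W₀
  have h1 := W.measurable_W₁
  rcases j with i | i
  · exact Measurable.ite hb measurable_const (by fun_prop)
  · exact Measurable.ite hb (by fun_prop) measurable_const

theorem measurable_chosenShock (hδ : Measurable δ) : Measurable (chosenShock δ) :=
  Measurable.ite (hδ (measurableSet_singleton true)) (by fun_prop) (by fun_prop)

theorem abs_chosenShock_le (z : State k × Shock) : |chosenShock δ z| ≤ ‖z.2‖ := by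
  unfold chosenShock
  split_ifs
  · exact norm_snd_le z.2
  · exact norm_fst_le z.2

theorem utility_eq (y : Bool) (z : State k × Shock) :
    utility W θ y z = ∑ j, θ j * feature W j (z.1, y) + if y then z.2.2 else z.2.1 := by
  cases y <;> simp [utility, feature, mul_comm]

theorem utility_choice_eq (z : State k × Shock) :
    utility W θ (δ z) z = ∑ j, θ j * feature W j (z.1, δ z) + chosenShock δ z :=
  utility_eq _ _

theorem phi_eq {D : Measure (ℕ → Obs k)} [IsProbabilityMeasure D] (j : Coord k₀ k₁)
    (x : State k) : phi W β D j x =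
      feature W j (x, true) - feature W j (x, false) + stateDiff D β (feature W j) x := by
  rcases j with i | i
  · simp only [phi, feature, if_true, Bool.false_eq_true, if_false, zero_sub]
    rfl
  · simp only [phi, feature, if_true, Bool.false_eq_true, if_false, sub_zero]
    rfl

theorem integrable_chosenShock (hδ : Measurable δ) (hF : Integrable (fun e : Shock => e) F)
    (A : Measure (State k)) [IsProbabilityMeasure A] : Integrable (chosenShock δ) (A.prod F) := by
  have h : Integrable (fun z : State k × Shock => ‖z.2‖) (A.prod F) := hF.norm.comp_snd A
  exact h.mono' (measurable_chosenShock hδ).aestronglyMeasurable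
    (Filter.Eventually.of_forall abs_chosenShock_le)

/-- If `δ` compares `ε₀ - ε₁` with the threshold `t`, then the choice probability is the
distribution function of `ε₀ - ε₁` at `t`, and the expected chosen shock is a truncated mean. -/
theorem threshold_choice (hF : Integrable (fun e : Shock => e) F)
    (hη : ContinuouslyDistributedOn (F.map fun e => e.1 - e.2) univ) {x : State k} {t : ℝ}
    (h : ∀ᵐ e ∂F, (δ (x, e) = true → e.1 - e.2 ≤ t) ∧ (δ (x, e) = false → t ≤ e.1 - e.2)) :
    F.real {e | δ (x, e) = true} = cdf (F.map fun e => e.1 - e.2) t ∧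
      ∫ e, chosenShock δ (x, e) ∂F =
        ∫ e, e.1 ∂F - ∫ u in Iic t, u ∂(F.map fun e => e.1 - e.2) := by
  have hm : Measurable fun e : Shock => e.1 - e.2 := by fun_prop
  have hprob : IsProbabilityMeasure (F.map fun e : Shock => e.1 - e.2) :=
    Measure.isProbabilityMeasure_map hm.aemeasurable
  have hna := hη.noAtoms
  have hne : ∀ᵐ e ∂F, e.1 - e.2 ≠ t :=
    ae_of_ae_map (p := fun u => u ≠ t) hm.aemeasurable (by simp [ae_iff])
  have hiff : ∀ᵐ e ∂F, δ (x, e) = true ↔ e.1 - e.2 ≤ t := by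
    filter_upwards [h, hne] with e h1 h2
    refine ⟨h1.1, fun h3 => ?_⟩
    by_contra h4
    exact h2 (le_antisymm h3 (h1.2 (by simpa using h4)))
  have h1 : Integrable (fun e : Shock => e.1) F := hF.fst
  have h2 : Integrable (fun e : Shock => e.2) F := hF.snd
  constructor
  · rw [cdf_eq_real, map_measureReal_apply hm measurableSet_Iic]
    refine measureReal_congr ?_
    filter_upwards [hiff] with e he
    exact propext he
  · have hind : Integrable (((fun e : Shock => e.1 - e.2) ⁻¹' Iic t).indicator
        fun e => e.1 - e.2) F := (h1.sub h2).indicator (hm measurableSet_Iic)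
    rw [setIntegral_map measurableSet_Iic measurable_id'.aestronglyMeasurable hm.aemeasurable,
      ← integral_indicator (hm measurableSet_Iic), ← integral_sub h1 hind]
    refine integral_congr_ae ?_
    filter_upwards [hiff] with e he
    by_cases hc : e.1 - e.2 ≤ t
    · simp [chosenShock, he.2 hc, indicator, hc]
    · simp [chosenShock, mt he.1 hc, indicator, hc]

end Deviation

/-! ### The optimality equation and identification -/

section Optimality

open scoped ENNReal

variable {k k₀ k₁ : ℕ} {κ : Kernel (Obs k) (State k)} [IsMarkovKernel κ]
  {δ : State k × Shock → Bool} {M : Model k k₀ k₁} {W : Transforms k k₀ k₁} {β pl pu : ℝ}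

/-- Discounted expectations of the components of utility are finite. -/
def FeatureDefined (W : Transforms k k₀ k₁) (β : ℝ) (D : Measure (ℕ → Obs k))
    [IsProbabilityMeasure D] (o : Obs k) : Prop :=
  ∀ j, (∀ s, Integrable (feature W j) (obsKernel D (s + 1) o)) ∧
    Summable fun s : ℕ => β ^ (s + 1) * ∫ o', |feature W j o'| ∂(obsKernel D (s + 1) o)

theorem ae_featureDefined {D : Measure (ℕ → Obs k)} [IsProbabilityMeasure D]
    (hβ : β ∈ Ioo (0 : ℝ) 1) (hp : ScoreInterval D pl pu) (hreg : Regular W β D) :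
    ∀ᵐ x ∂(stateLaw D), ∀ y, FeatureDefined W β D (x, y) := by
  have hm0 := W.measurable_W₀
  have hm1 := W.measurable_W₁
  filter_upwards [hp.ae_tsum_lt_top (β := β) hm0.enorm hreg.finite_W₀.2,
    hp.ae_tsum_lt_top (β := β) hm1.enorm hreg.finite_W₁.2] with x h0 h1 y j
  refine integrable_summable_of_tsum_lintegral hβ (measurable_feature j) ?_
  have hle : ∀ {E : Type} [NormedAddCommGroup E] (f : State k → E),
      (∀ o, ‖feature W j o‖ ≤ ‖f o.1‖) →
      (∑' s : ℕ, ENNReal.ofReal (β ^ (s + 1)) *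
        ∫⁻ o, ‖f o.1‖ₑ ∂(obsKernel D (s + 1) (x, y)) < ⊤) →
      ∑' s : ℕ, ENNReal.ofReal (β ^ (s + 1)) *
        ∫⁻ o, ‖feature W j o‖ₑ ∂(obsKernel D (s + 1) (x, y)) < ⊤ := by
    intro E _ f hf h
    refine lt_of_le_of_lt (ENNReal.tsum_le_tsum fun s => ?_) h
    gcongr with o
    exact enorm_le_iff_norm_le.2 (hf o)
  rcases j with i | i
  · refine hle W.W₀ (fun o => ?_) (h0 y)
    simp only [feature]
    split_ifs
    · simp
    · exact PiLp.norm_apply_le (W.W₀ o.1) i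
  · refine hle W.W₁ (fun o => ?_) (h1 y)
    simp only [feature]
    split_ifs
    · exact PiLp.norm_apply_le (W.W₁ o.1) i
    · simp

/-- Absolute convergence for the observed components of utility gives it for utility. -/
theorem futureDefined_of_featureDefined (hβ : β ∈ Ioo (0 : ℝ) 1) (hδ : Measurable δ)
    (hF : Integrable (fun e : Shock => e) M.shockLaw) {o : Obs k}
    (hobs : ∀ s, obsKernel M.observed (s + 1) o =
      ((stateKernel κ M.shockLaw δ s o).prod M.shockLaw).map fun z => (z.1, δ z))
    (h : FeatureDefined W β M.observed o) : FutureDefined W β M.θ κ M.shockLaw δ o := by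
  have hA := isMarkovKernel_stateKernel (κ := κ) (F := M.shockLaw) hδ
  have hz : Measurable fun z : State k × Shock => (z.1, δ z) := by fun_prop
  have hfi : ∀ s j, Integrable (fun z => feature W j (z.1, δ z))
      ((stateKernel κ M.shockLaw δ s o).prod M.shockLaw) := by
    intro s j
    have := (h j).1 s
    rw [hobs s] at this
    exact this.comp_measurable hz
  have hsi : ∀ s, Integrable (chosenShock δ)
      ((stateKernel κ M.shockLaw δ s o).prod M.shockLaw) := fun s =>
    integrable_chosenShock hδ hF _
  have hsum : ∀ s, Integrable (fun z => ∑ j, M.θ j * feature W j (z.1, δ z))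
      ((stateKernel κ M.shockLaw δ s o).prod M.shockLaw) := fun s =>
    integrable_finsetSum _ fun j _ => (hfi s j).const_mul _
  have hint : ∀ s, Integrable (fun z => utility W M.θ (δ z) z)
      ((stateKernel κ M.shockLaw δ s o).prod M.shockLaw) := by
    intro s
    simp_rw [utility_choice_eq]
    exact (hsum s).add (hsi s)
  refine ⟨hint, ?_⟩
  have hbound : Summable fun s : ℕ => ∑ j, |M.θ j| *
      (β ^ (s + 1) * ∫ o', |feature W j o'| ∂(obsKernel M.observed (s + 1) o)) +
        β ^ (s + 1) * ∫ e, ‖e‖ ∂M.shockLaw :=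
    (summable_sum fun j _ => (h j).2.mul_left _).add (summable_discount hβ _)
  refine hbound.of_nonneg_of_le (fun s => mul_nonneg (pow_pos hβ.1 _).le
    (integral_nonneg fun _ => abs_nonneg _)) fun s => ?_
  have hnorm : Integrable (fun z : State k × Shock => ‖z.2‖)
      ((stateKernel κ M.shockLaw δ s o).prod M.shockLaw) := hF.norm.comp_snd _
  have h1 : ∫ z, |utility W M.θ (δ z) z| ∂((stateKernel κ M.shockLaw δ s o).prod M.shockLaw) ≤
      ∫ z, (∑ j, |M.θ j| * |feature W j (z.1, δ z)| + ‖z.2‖)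
        ∂((stateKernel κ M.shockLaw δ s o).prod M.shockLaw) := by
    refine integral_mono (hint s).abs ((integrable_finsetSum _ fun j _ =>
      (hfi s j).abs.const_mul _).add hnorm) fun z => ?_
    simp only
    rw [utility_choice_eq]
    refine (abs_add_le _ _).trans (add_le_add ?_ (abs_chosenShock_le z))
    refine (Finset.abs_sum_le_sum_abs _ _).trans (le_of_eq ?_)
    exact Finset.sum_congr rfl fun j _ => abs_mul _ _
  have h2 : ∫ z, (∑ j, |M.θ j| * |feature W j (z.1, δ z)| + ‖z.2‖)
        ∂((stateKernel κ M.shockLaw δ s o).prod M.shockLaw) =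
      ∑ j, |M.θ j| * ∫ o', |feature W j o'| ∂(obsKernel M.observed (s + 1) o) +
        ∫ e, ‖e‖ ∂M.shockLaw := by
    rw [integral_add (integrable_finsetSum _ fun j _ => (hfi s j).abs.const_mul _) hnorm,
      integral_finsetSum _ fun j _ => (hfi s j).abs.const_mul _]
    simp_rw [integral_const_mul]
    congr 1
    · refine Finset.sum_congr rfl fun j _ => ?_
      rw [hobs s, integral_map (f := fun o' => |feature W j o'|) hz.aemeasurable
        (measurable_feature j).norm.aestronglyMeasurable]
    · rw [integral_fun_snd (fun e : Shock => ‖e‖), probReal_univ, one_smul]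
  calc _ ≤ β ^ (s + 1) * (∑ j, |M.θ j| * ∫ o', |feature W j o'| ∂(obsKernel M.observed (s + 1) o) +
        ∫ e, ‖e‖ ∂M.shockLaw) :=
        mul_le_mul_of_nonneg_left (h1.trans h2.le) (pow_pos hβ.1 _).le
    _ = _ := by
        rw [mul_add, Finset.mul_sum]
        congr 1
        exact Finset.sum_congr rfl fun j _ => by ring

theorem measurable_futureUtility {F : Measure Shock} [IsProbabilityMeasure F] (hδ : Measurable δ)
    (θ : EuclideanSpace ℝ (Coord k₀ k₁)) (s : ℕ) : Measurable (futureUtility W θ κ F δ s) := by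
  have hA := isMarkovKernel_stateKernel (κ := κ) (F := F) hδ
  have hu : Measurable fun z => utility W θ (δ z) z := by
    simp_rw [utility_choice_eq]
    refine Measurable.add ?_ (measurable_chosenShock hδ)
    exact Finset.measurable_sum _ fun j _ => ((measurable_feature j).comp (by fun_prop)).const_mul _
  have h : StronglyMeasurable fun o => ∫ z, utility W θ (δ z) z
      ∂((stateKernel κ F δ s ×ₖ Kernel.const (Obs k) F) o) :=
    hu.stronglyMeasurable.integral_kernel
  simp_rw [Kernel.prod_apply, Kernel.const_apply] at h
  exact h.measurable

/-- The difference of the choice-specific values of the two actions, net of the shocks. -/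
def valueDiff (W : Transforms k k₀ k₁) (β : ℝ) (θ : EuclideanSpace ℝ (Coord k₀ k₁))
    (κ : Kernel (Obs k) (State k)) (F : Measure Shock) (δ : State k × Shock → Bool)
    (x : State k) : ℝ :=
  (∑ j, θ j * feature W j (x, true) + ∑' s : ℕ, β ^ (s + 1) * futureUtility W θ κ F δ s (x, true)) -
  (∑ j, θ j * feature W j (x, false) +
    ∑' s : ℕ, β ^ (s + 1) * futureUtility W θ κ F δ s (x, false))

theorem measurable_valueDiff {F : Measure Shock} [IsProbabilityMeasure F] (hδ : Measurable δ)
    (θ : EuclideanSpace ℝ (Coord k₀ k₁)) : Measurable (valueDiff W β θ κ F δ) := by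
  have h : ∀ y, Measurable fun x : State k => ∑ j, θ j * feature W j (x, y) +
      ∑' s : ℕ, β ^ (s + 1) * futureUtility W θ κ F δ s (x, y) := by
    intro y
    refine Measurable.add ?_ (Measurable.tsum fun s => ?_)
    · exact Finset.measurable_sum _ fun j _ =>
        ((measurable_feature j).comp measurable_prodMk_right).const_mul _
    · exact ((measurable_futureUtility hδ θ s).comp measurable_prodMk_right).const_mul _
  exact (h true).sub (h false)

/-- Optimal choices compare `ε₀ - ε₁` with the difference of the choice-specific values. -/
theorem ae_threshold (hβ : β ∈ Ioo (0 : ℝ) 1) (hE : IsEquilibrium W β M)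
    (hT : ∀ x e y, M.trans (x, e, y) = (κ (x, y)).prod M.shockLaw) (hδ : Measurable δ)
    (hopt : ∀ᵐ ω ∂M.law, IsOptimalAt W β M.θ M.trans (Plan.stationary δ hδ) ((ω 0).1, (ω 0).2.1))
    (hfut : ∀ᵐ x ∂(stateLaw M.observed), ∀ y, FutureDefined W β M.θ κ M.shockLaw δ (x, y)) :
    ∀ᵐ x ∂(stateLaw M.observed), ∀ᵐ e ∂M.shockLaw,
      (δ (x, e) = true → e.1 - e.2 ≤ valueDiff W β M.θ κ M.shockLaw δ x) ∧
      (δ (x, e) = false → valueDiff W β M.θ κ M.shockLaw δ x ≤ e.1 - e.2) := by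
  have hv := measurable_valueDiff (W := W) (β := β) (κ := κ) (F := M.shockLaw) hδ M.θ
  have hms : MeasurableSet {z : State k × Shock |
      (δ z = true → z.2.1 - z.2.2 ≤ valueDiff W β M.θ κ M.shockLaw δ z.1) ∧
      (δ z = false → valueDiff W β M.θ κ M.shockLaw δ z.1 ≤ z.2.1 - z.2.2)} := by
    have e : {z : State k × Shock |
      (δ z = true → z.2.1 - z.2.2 ≤ valueDiff W β M.θ κ M.shockLaw δ z.1) ∧
      (δ z = false → valueDiff W β M.θ κ M.shockLaw δ z.1 ≤ z.2.1 - z.2.2)} =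
      ((δ ⁻¹' {true})ᶜ ∪ {z | z.2.1 - z.2.2 ≤ valueDiff W β M.θ κ M.shockLaw δ z.1}) ∩
      ((δ ⁻¹' {false})ᶜ ∪ {z | valueDiff W β M.θ κ M.shockLaw δ z.1 ≤ z.2.1 - z.2.2}) := by
      ext z
      simp [imp_iff_not_or]
    rw [e]
    refine ((hδ (measurableSet_singleton _)).compl.union (measurableSet_le ?_ ?_)).inter
      ((hδ (measurableSet_singleton _)).compl.union (measurableSet_le ?_ ?_))
    all_goals fun_prop
  refine Measure.ae_ae_of_ae_prod (p := fun z : State k × Shock =>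
      (δ z = true → z.2.1 - z.2.2 ≤ valueDiff W β M.θ κ M.shockLaw δ z.1) ∧
      (δ z = false → valueDiff W β M.θ κ M.shockLaw δ z.1 ≤ z.2.1 - z.2.2)) ?_
  -- Optimality need not be a measurable property of `(x, ε)`, so it is replaced by the inequalities
  -- it implies before passing to the law of `(X, ε)`.
  rw [← map_state_shock hE hT, ae_map_iff (Measurable.aemeasurable (by fun_prop)) hms]
  rw [stateLaw_observed] at hfut
  filter_upwards [hopt, ae_of_ae_map (Measurable.aemeasurable (by fun_prop)) hfut] with ω h1 h2
  have h3 := deviation_le hT hδ hβ.1 h2 h1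
  rw [utility_eq, utility_eq] at h3
  constructor
  · intro hd
    rw [hd] at h3
    simp only [Bool.not_true, Bool.false_eq_true, if_false, if_true] at h3
    rw [valueDiff]
    linarith
  · intro hd
    rw [hd] at h3
    simp only [Bool.not_false, Bool.false_eq_true, if_false, if_true] at h3
    rw [valueDiff]
    linarith

end Optimality

section Equation

variable {k k₀ k₁ : ℕ} {κ : Kernel (Obs k) (State k)} [IsMarkovKernel κ]
  {δ : State k × Shock → Bool} {M : Model k k₀ k₁} {W : Transforms k k₀ k₁} {β pl pu : ℝ}

/-- Expected future utility consists of the expected observed components, weighted by `θ`, and the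
expected shock of the chosen action, which depends on the state only through its choice
probability. -/
theorem futureUtility_eq (hδ : Measurable δ) (hF : Integrable (fun e : Shock => e) M.shockLaw)
    {o : Obs k} (hobs : ∀ s, obsKernel M.observed (s + 1) o =
      ((stateKernel κ M.shockLaw δ s o).prod M.shockLaw).map fun z => (z.1, δ z))
    (h : FeatureDefined W β M.observed o) {g : State k → ℝ} (hg : Measurable g) {C c : ℝ}
    (hC : ∀ x, |g x| ≤ C)
    (hS : ∀ s, ∀ᵐ o' ∂(obsKernel M.observed (s + 1) o),
      ∫ e, chosenShock δ (o'.1, e) ∂M.shockLaw = c - g o'.1) (s : ℕ) :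
    futureUtility W M.θ κ M.shockLaw δ s o =
      ∑ j, M.θ j * ∫ o', feature W j o' ∂(obsKernel M.observed (s + 1) o) +
        (c - ∫ o', g o'.1 ∂(obsKernel M.observed (s + 1) o)) := by
  have hA := isMarkovKernel_stateKernel (κ := κ) (F := M.shockLaw) hδ
  have hz : Measurable fun z : State k × Shock => (z.1, δ z) := by fun_prop
  have hfi : ∀ j, Integrable (fun z => feature W j (z.1, δ z))
      ((stateKernel κ M.shockLaw δ s o).prod M.shockLaw) := by
    intro j
    have := (h j).1 s
    rw [hobs s] at this
    exact this.comp_measurable hz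
  have hsi := integrable_chosenShock hδ hF (stateKernel κ M.shockLaw δ s o)
  have hshock : ∫ z, chosenShock δ z ∂((stateKernel κ M.shockLaw δ s o).prod M.shockLaw) =
      c - ∫ o', g o'.1 ∂(obsKernel M.observed (s + 1) o) := by
    have h1 : ∀ᵐ x ∂(stateKernel κ M.shockLaw δ s o),
        ∫ e, chosenShock δ (x, e) ∂M.shockLaw = c - g x := by
      have h2 := hS s
      rw [hobs s] at h2
      have h3 := Measure.ae_ae_of_ae_prod (ae_of_ae_map hz.aemeasurable h2)
      exact h3.mono fun x hx => Filter.eventually_const.1 hx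
    rw [integral_prod _ hsi, integral_congr_ae h1, integral_sub (integrable_const _)
      (integrable_of_abs_le hg hC), integral_const, probReal_univ, one_smul, hobs s,
      integral_map (f := fun o' : Obs k => g o'.1) hz.aemeasurable
        (hg.comp measurable_fst).aestronglyMeasurable, integral_fun_fst, probReal_univ, one_smul]
  rw [futureUtility]
  simp_rw [utility_choice_eq]
  rw [integral_add (integrable_finsetSum _ fun j _ => (hfi j).const_mul _) hsi,
    integral_finsetSum _ fun j _ => (hfi j).const_mul _, hshock]
  simp_rw [integral_const_mul]
  congr 1
  refine Finset.sum_congr rfl fun j _ => ?_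
  rw [hobs s, integral_map hz.aemeasurable (measurable_feature j).aestronglyMeasurable]

theorem FeatureDefined.summable_diff {D : Measure (ℕ → Obs k)} [IsProbabilityMeasure D] {x : State k}
    (hβ : β ∈ Ioo (0 : ℝ) 1) (h : ∀ y, FeatureDefined W β D (x, y)) (j : Coord k₀ k₁) :
    Summable fun s : ℕ => β ^ (s + 1) * ((∫ o, feature W j o ∂(obsKernel D (s + 1) (x, true))) -
      ∫ o, feature W j o ∂(obsKernel D (s + 1) (x, false))) := by
  have h1 : ∀ y, Summable fun s : ℕ =>
      β ^ (s + 1) * ∫ o, feature W j o ∂(obsKernel D (s + 1) (x, y)) := by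
    intro y
    refine Summable.of_norm_bounded (h y j).2 fun s => ?_
    rw [norm_mul, Real.norm_of_nonneg (pow_pos hβ.1 _).le]
    exact mul_le_mul_of_nonneg_left (norm_integral_le_integral_norm _) (pow_pos hβ.1 _).le
  simp_rw [mul_sub]
  exact (h1 true).sub (h1 false)

theorem Admissible.integrable_etaLaw (hM : Admissible W β M) :
    Integrable (fun t => t) M.etaLaw := by
  rw [Model.etaLaw, integrable_map_measure measurable_id'.aestronglyMeasurable
    (Measurable.aemeasurable (by fun_prop))]
  exact hM.shock_integrable.fst.sub hM.shock_integrable.snd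

/-- The optimality equation: the quantile of `ε₀ - ε₁` at the choice probability is the value
difference, expressed through the law of the observables and the quantile function itself. -/
theorem ae_quantile_eq (hβ : β ∈ Ioo (0 : ℝ) 1) (hM : Admissible W β M)
    (hreg : Regular W β M.observed) (hp : ScoreInterval M.observed pl pu) :
    ∀ᵐ x ∂(stateLaw M.observed), quantile M.etaLaw (choiceProb M.observed x) =
      ∑ j, M.θ j * phi W β M.observed j x - stateDiff M.observed β
        (fun o => primitive pl pu (quantile M.etaLaw) (choiceProb M.observed o.1)) x := by
  obtain ⟨κ, hκ, hT⟩ := hM.condIndep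
  have hE := hM.equilibrium
  obtain ⟨δ, hδ, hY, hopt⟩ := hE.optimal
  have hF := hM.shock_integrable
  have hη := hM.eta_continuous
  have hst := map_state_observed hE
  have hm := measurable_choiceProb (D := M.observed)
  have hb := hp.bounds
  have hsub : Icc pl pu ⊆ Icc (0 : ℝ) 1 := Icc_subset_Icc hb.1 hb.2.2
  have hQ01 := integrableOn_quantile hη hM.integrable_etaLaw
  have hQ : IntegrableOn (quantile M.etaLaw) (Icc pl pu) := hQ01.mono_set hsub
  set Q := quantile M.etaLaw with hQdef
  have hobs := hp.ae_forall_action (ae_obsKernel_eq hE hT hδ hY)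
  have hfeat := ae_featureDefined hβ hp hreg
  have hfut : ∀ᵐ x ∂(stateLaw M.observed), ∀ y,
      FutureDefined W β M.θ κ M.shockLaw δ (x, y) := by
    filter_upwards [hobs, hfeat] with x h1 h2 y
    exact futureDefined_of_featureDefined hβ hδ hF (h1 y) (h2 y)
  have hthr := ae_threshold hβ hE hT hδ hopt hfut
  -- `c` is the expected chosen shock where the choice probability is `pl`.
  set c : ℝ := ∫ e, e.1 ∂M.shockLaw - ∫ τ in (0 : ℝ)..pl, Q τ with hc
  have hchoice : ∀ᵐ x ∂(stateLaw M.observed),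
      Q (choiceProb M.observed x) = valueDiff W β M.θ κ M.shockLaw δ x ∧
      ∫ e, chosenShock δ (x, e) ∂M.shockLaw =
        c - primitive pl pu Q (choiceProb M.observed x) := by
    filter_upwards [hthr, ae_choiceProb_eq hE hT hδ hY, hp.ae_mem] with x h1 h2 h3
    obtain ⟨h4, h5⟩ := threshold_choice hF hη h1
    have h6 : choiceProb M.observed x = cdf M.etaLaw (valueDiff W β M.θ κ M.shockLaw δ x) :=
      h2.trans h4
    refine ⟨by rw [h6, hQdef, quantile_cdf hη], ?_⟩
    have h7 : ∫ u in Iic (valueDiff W β M.θ κ M.shockLaw δ x), u ∂M.etaLaw =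
        ∫ τ in (0 : ℝ)..choiceProb M.observed x, Q τ := by
      rw [setIntegral_Iic_eq_integral_quantile hη, h6]
    have hI : ∀ {a b : ℝ}, a ∈ Icc (0 : ℝ) 1 → b ∈ Icc (0 : ℝ) 1 →
        IntervalIntegrable Q volume a b := fun ha hb' =>
      (hQ01.mono_set (uIcc_subset_Icc ha hb')).intervalIntegrable
    have hpl : pl ∈ Icc (0 : ℝ) 1 := hsub ⟨le_rfl, hb.2.1.le⟩
    have h8 := intervalIntegral.integral_add_adjacent_intervals
      (hI (left_mem_Icc.2 zero_le_one) hpl) (hI hpl (hsub h3.2))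
    refine h5.trans ?_
    have h9 : ∫ u in Iic (valueDiff W β M.θ κ M.shockLaw δ x), u
      ∂(M.shockLaw.map fun e => e.1 - e.2) = _ := h7
    rw [h9, primitive_eq h3.2, hc]
    linarith
  have hprim : Measurable fun x => primitive pl pu Q (choiceProb M.observed x) :=
    (continuous_primitive_Icc hQ).measurable.comp hm
  filter_upwards [hchoice, hobs, hfeat, hfut, hp.ae_obsKernel hst hchoice]
    with x h1 h2 h3 h4 h5
  have hfu : ∀ s y, futureUtility W M.θ κ M.shockLaw δ s (x, y) = _ := fun s y =>
    futureUtility_eq hδ hF (h2 y) (h3 y) hprim (fun x' => abs_primitive_le hQ _)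
      (fun s => (h5 (s + 1) y).mono fun o ho => ho.2) s
  have hd1 : Summable fun s : ℕ => ∑ j, M.θ j * (β ^ (s + 1) *
      ((∫ o, feature W j o ∂(obsKernel M.observed (s + 1) (x, true))) -
        ∫ o, feature W j o ∂(obsKernel M.observed (s + 1) (x, false)))) :=
    summable_sum fun j _ => (FeatureDefined.summable_diff hβ h3 j).mul_left _
  have hd2 := summable_discountedDiff (β := β) hβ
    (κ := fun s y => obsKernel M.observed (s + 1) (x, y))
    (f := fun o => primitive pl pu Q (choiceProb M.observed o.1)) (fun o => abs_primitive_le hQ _)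
  have hseries : (∑' s : ℕ, β ^ (s + 1) * futureUtility W M.θ κ M.shockLaw δ s (x, true)) -
      ∑' s : ℕ, β ^ (s + 1) * futureUtility W M.θ κ M.shockLaw δ s (x, false) =
      ∑ j, M.θ j * stateDiff M.observed β (feature W j) x - stateDiff M.observed β
        (fun o => primitive pl pu Q (choiceProb M.observed o.1)) x := by
    simp_rw [stateDiff_eq_discountedDiff]
    unfold discountedDiff
    simp_rw [← tsum_mul_left]
    rw [← ((h4 true).summable_futureUtility hβ.1).tsum_sub
      ((h4 false).summable_futureUtility hβ.1),
      ← Summable.tsum_finsetSum fun j _ => (FeatureDefined.summable_diff hβ h3 j).mul_left _]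
    refine Eq.trans (tsum_congr fun s => ?_) (hd1.tsum_sub hd2)
    rw [hfu, hfu]
    have e : ∑ j, M.θ j * (β ^ (s + 1) *
        ((∫ o, feature W j o ∂(obsKernel M.observed (s + 1) (x, true))) -
          ∫ o, feature W j o ∂(obsKernel M.observed (s + 1) (x, false)))) =
        β ^ (s + 1) * (∑ j, M.θ j * ∫ o, feature W j o ∂(obsKernel M.observed (s + 1) (x, true)) -
          ∑ j, M.θ j * ∫ o, feature W j o ∂(obsKernel M.observed (s + 1) (x, false))) := by
      rw [← Finset.sum_sub_distrib, Finset.mul_sum]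
      exact Finset.sum_congr rfl fun j _ => by ring
    rw [e]
    ring
  have hphi : ∑ j, M.θ j * phi W β M.observed j x =
      ∑ j, M.θ j * feature W j (x, true) - ∑ j, M.θ j * feature W j (x, false) +
        ∑ j, M.θ j * stateDiff M.observed β (feature W j) x := by
    rw [← Finset.sum_sub_distrib, ← Finset.sum_add_distrib]
    exact Finset.sum_congr rfl fun j _ => by rw [phi_eq]; ring
  rw [h1.1, valueDiff, hphi]
  linarith

/-- In an admissible structure, the quantile of `ε₀ - ε₁` at the choice probability is the index
`θ·m(X)`. -/
theorem ae_quantile_eq_index (hβ : β ∈ Ioo (0 : ℝ) 1) (hM : Admissible W β M)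
    (hreg : Regular W β M.observed) (hp : ScoreInterval M.observed pl pu)
    (hcontr : Contraction β M.observed pl pu) {B : Coord k₀ k₁ → ℝ → ℝ}
    (hB : IsBasisSolution W β M.observed pl pu B) :
    ∀ᵐ x ∂(stateLaw M.observed), quantile M.etaLaw (choiceProb M.observed x) =
      ∑ j, M.θ j * mIndex W β M.observed pl B j x := by
  have hb := hp.bounds
  exact ae_eq_index W hβ hreg.integrable_phi hp (map_state_observed hM.equilibrium) hcontr hB
    ((integrableOn_quantile hM.eta_continuous hM.integrable_etaLaw).mono_set
      (Icc_subset_Icc hb.1 hb.2.2)) M.θ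
    (ae_quantile_eq hβ hM hreg hp)

end Equation

end DDC
end

theorem theorem2 {k k₀ k₁ : ℕ} (W : DDC.Transforms k k₀ k₁) (β : ℝ) (hβ : β ∈ Set.Ioo (0 : ℝ) 1)
    (M : DDC.Model k k₀ k₁) (hM : DDC.Admissible W β M)
    (hreg : DDC.Regular W β M.observed)
    (pl pu : ℝ) (hp : DDC.ScoreInterval M.observed pl pu)
    (hcontr : DDC.Contraction β M.observed pl pu)
    (B : DDC.Coord k₀ k₁ → ℝ → ℝ) (hB : DDC.IsBasisSolution W β M.observed pl pu B)
    (j₀ : DDC.Coord k₀ k₁)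
    (hm : DDC.IndexCondition M.observed (DDC.mIndex W β M.observed pl B) j₀)
    (hθ : M.θ j₀ ≠ 0) :
    DDC.PointIdentified {M' : DDC.Model k k₀ k₁ | DDC.Admissible W β M'} M := by
  intro M' hM' hobs
  have hM'' : DDC.Admissible W β M' := hM'
  have h1 := DDC.ae_quantile_eq_index hβ hM hreg hp hcontr hB
  have h2 : ∀ᵐ x ∂(DDC.stateLaw M.observed),
      DDC.quantile M'.etaLaw (DDC.choiceProb M.observed x) =
        ∑ j, M'.θ j * DDC.mIndex W β M.observed pl B j x := by
    -- The functionals depend on `M'` only through the common law of the observables.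
    have key : ∀ (D : Measure (ℕ → DDC.Obs k)) [IsProbabilityMeasure D], M'.observed = D →
        DDC.Regular W β D → DDC.ScoreInterval D pl pu → DDC.Contraction β D pl pu →
        DDC.IsBasisSolution W β D pl pu B → ∀ᵐ x ∂(DDC.stateLaw D),
          DDC.quantile M'.etaLaw (DDC.choiceProb D x) =
            ∑ j, M'.θ j * DDC.mIndex W β D pl B j x := by
      rintro D _ rfl h1 h2 h3 h4
      exact DDC.ae_quantile_eq_index hβ hM'' h1 h2 h3 h4
    exact key M.observed hobs hreg hp hcontr hB
  exact (DDC.eq_of_single_index hm hM.eta_continuous hM''.eta_continuous hM.norm_theta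
    hM''.norm_theta hθ DDC.measurable_choiceProb hp hp.ae_mem h1 h2).symm
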